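/- **Setting.** Let $\mathcal X$ be a measurable space, $[c]$ a set of $c$ classes, and $\mathcal F$ a finite nonempty set of measurable functions $\mathcal X\to\{0,1\}$. A problem instance is a labeled dataset $D=(X,y)\in\mathcal X^n\times[c]^n$. In a decision tree, internal nodes are labeled by functions in $\mathcal F$, which send each point to the left or right child, and leaves are labeled by classes; $T(x)$ denotes the prediction of $T$ on $x$. For a leaf $l$ of $T$ let $w(l)$ be the number of examples of $D$ mapped to $l$, and let $p_i(l)$ be the fraction of them with label $i$. For $\gamma\in(0,1]$ and a constant $C$ put $$g_\gamma(p_1,\dots,p_c)=C\Big(\prod_{i=1}^c p_i\Big)^\gamma,\qquad G_\gamma(T)=\sum_{l\in\mathrm{leaves}(T)}w(l)\,g_\gamma(p_1(l),\dots,p_c(l)),$$ where a leaf $l$ with $w(l)=0$ contributes $0$. Let $T_{l\to f}$ be the tree obtained from $T$ by replacing the leaf $l$ by an internal node labeled $f$ with two new leaf children, each labeled by the most frequent label among the examples mapped to it. The top-down learner starts with a single leaf labeled by the most frequent label in $D$ and performs $t\ge 1$ rounds; each round replaces the current tree $T$ by $T_{l^*\to f^*}$, where $(l^*,f^*)$ minimizes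 $G_\gamma(T_{l\to f})$ over leaves $l$ of $T$ and $f\in\mathcal F$. Ties (among labels and among splits) are resolved by a fixed deterministic rule that does not depend on $\gamma$: for labels it is a function of the set of tied labels, for splits it is a function of the current tree and the set of tied splits. Let $T_{\gamma}(D)$ be the resulting tree with $t$ internal nodes, and $L_\gamma(D)=\frac1n\sum_{i=1}^n\mathbf 1[T_\gamma(D)(X_i)\neq y_i]$. Given problem instances $D_1,\dots,D_N$, an ERM parameter is any $\hat\gamma\in(0,1]$ that minimizes $\sum_{j=1}^N L_\gamma(D_j)$ over $\gamma\in(0,1]$. **Theorem.** (a) There is a universal constant $A>0$ such that for all $\mathcal X,c,n,t\ge1,\mathcal F,C$ and tie-breaking rule as above, all $\epsilon,\delta>0$, every probability distribution $\mathcal D$ over problem instances with $n$ examples, and every $$N\ \ge\ \frac{A}{\epsilon^2}\Big(t\,(\log|\mathcal F|+\log t)+\log\frac1\delta\Big),$$ with probability at least $1-\delta$ over $N$ independent samples $D_1,\dots,D_N\sim\mathcal D$, every ERM parameter $\hat\gamma$ is $\epsilon$-optimal, i.e. $\mathbb E_{D\sim\mathcal D}L_{\hat\gamma}(D)\le\mathbb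 E_{D\sim\mathcal D}L_{\gamma}(D)+\epsilon$ for all $\gamma\in(0,1]$. (b) There is a universal constant $K$ such that for every dataset $D$, every decision tree $T$, all leaves $l_1,l_2$ of $T$ and all node functions $f_1,f_2:\mathcal X\to\{0,1\}$, either $G_\gamma(T_{l_1\to f_1})=G_\gamma(T_{l_2\to f_2})$ for all $\gamma\in(0,1]$, or this equation has at most $K$ solutions $\gamma\in(0,1]$. -/

import Mathlib

universe u

namespace TopDown

/-- A labeled dataset with `n` examples in the input domain `𝒳` and `c` classes. -/
abbrev Dataset (𝒳 : Type u) (c n : ℕ) : Type u := Fin n → 𝒳 × Fin c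

/-- Binary decision trees: leaves carry a class, internal nodes carry a boolean node function. -/
inductive DTree (𝒳 : Type u) (c : ℕ) : Type u
  | leaf (y : Fin c) : DTree 𝒳 c
  | node (f : 𝒳 → Bool) (l r : DTree 𝒳 c) : DTree 𝒳 c

namespace DTree

variable {𝒳 : Type u} {c : ℕ}

/-- The addresses of the leaves (`false` means left child, `true` means right child). -/
def leaves : DTree 𝒳 c → Finset (List Bool)
  | leaf _ => {[]}
  | node _ l r => l.leaves.image (List.cons false) ∪ r.leaves.image (List.cons true)

/-- The address of the leaf that a point is mapped to. -/
def leafOf : DTree 𝒳 c → 𝒳 → List Bool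
  | leaf _, _ => []
  | node f l r, x => if f x then true :: r.leafOf x else false :: l.leafOf x

/-- The prediction `T(x)`. -/
def predict : DTree 𝒳 c → 𝒳 → Fin c
  | leaf y, _ => y
  | node f l r, x => if f x then r.predict x else l.predict x

/-- Replace the leaf at address `a` by an internal node labeled by `f` whose two new leaf children
are labeled by `y₀` (left) and `y₁` (right); no effect if `a` is not the address of a leaf. -/
def replaceLeaf : DTree 𝒳 c → List Bool → (𝒳 → Bool) → Fin c → Fin c → DTree 𝒳 c
  | leaf _, [], f, y₀, y₁ => node f (leaf y₀) (leaf y₁)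
  | node g l r, false :: a, f, y₀, y₁ => node g (l.replaceLeaf a f y₀ y₁) r
  | node g l r, true :: a, f, y₀, y₁ => node g l (r.replaceLeaf a f y₀ y₁)
  | T, _, _, _, _ => T

end DTree

noncomputable section

variable {𝒳 : Type u} {c n : ℕ}

/-- The indices of the examples that are mapped to the leaf at address `a`. -/
def points (D : Dataset 𝒳 c n) (T : DTree 𝒳 c) (a : List Bool) : Finset (Fin n) :=
  {i | T.leafOf (D i).1 = a}

/-- The number of examples with label `k` among those with index in `s`. -/
def labelCount (D : Dataset 𝒳 c n) (s : Finset (Fin n)) (k : Fin c) : ℕ :=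
  (s.filter fun i => (D i).2 = k).card

/-- The weight `w(l)` of the leaf at address `a`. -/
def weight (D : Dataset 𝒳 c n) (T : DTree 𝒳 c) (a : List Bool) : ℕ := (points D T a).card

/-- The fraction `p_k(l)` of examples labeled `k` among those mapped to the leaf at address `a`.
For a leaf without examples this is `0`, but such a leaf has weight `0` anyway. -/
def classFrac (D : Dataset 𝒳 c n) (T : DTree 𝒳 c) (a : List Bool) (k : Fin c) : ℝ :=
  (labelCount D (points D T a) k : ℝ) / (weight D T a : ℝ)

/-- The splitting criterion `g_γ(p) = C (∏ p_i)^γ`. -/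
def splitCriterion (C γ : ℝ) (p : Fin c → ℝ) : ℝ := C * (∏ i, p i) ^ γ

/-- The splitting function `G_γ(T)`, the sum over the leaves of `w(l) g_γ(p(l))`. -/
def splitFun (C γ : ℝ) (D : Dataset 𝒳 c n) (T : DTree 𝒳 c) : ℝ :=
  ∑ a ∈ T.leaves, (weight D T a : ℝ) * splitCriterion C γ (classFrac D T a)

/-- The labels that are most frequent among the examples with index in `s`. -/
def mostFrequent (D : Dataset 𝒳 c n) (s : Finset (Fin n)) : Finset (Fin c) :=
  {k | ∀ k', labelCount D s k' ≤ labelCount D s k}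

/-- A fixed deterministic way to resolve ties: between equally frequent labels, and between equally
good splits (leaf address and node function) of the current tree. It does not depend on `γ`. -/
structure TieBreak (𝒳 : Type u) (c : ℕ) where
  pickLabel : Finset (Fin c) → Fin c
  pickLabel_mem : ∀ s, s.Nonempty → pickLabel s ∈ s
  pickSplit : DTree 𝒳 c → Finset (List Bool × (𝒳 → Bool)) → List Bool × (𝒳 → Bool)
  pickSplit_mem : ∀ T s, s.Nonempty → pickSplit T s ∈ s

/-- The most frequent label among the examples with index in `s`, up to ties. -/
def majority (B : TieBreak 𝒳 c) (D : Dataset 𝒳 c n) (s : Finset (Fin n)) : Fin c :=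
  B.pickLabel (mostFrequent D s)

/-- The split tree `T_{l → f}`, where `l` is the leaf at address `a`; each of the two new leaves is
labeled by the most frequent label among the examples that are mapped to it. -/
def split (B : TieBreak 𝒳 c) (D : Dataset 𝒳 c n) (T : DTree 𝒳 c) (a : List Bool)
    (f : 𝒳 → Bool) : DTree 𝒳 c :=
  T.replaceLeaf a f
    (majority B D ((points D T a).filter fun i => f (D i).1 = false))
    (majority B D ((points D T a).filter fun i => f (D i).1 = true))

/-- The splits `(l, f)` available for `T`, with `l` a leaf and `f` in the node function class. -/
def candidates (F : Finset (𝒳 → Bool)) (T : DTree 𝒳 c) : Finset (List Bool × (𝒳 → Bool)) :=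
  T.leaves ×ˢ F

open Classical in
/-- The set of minimizers of `G_γ(T_{l → f})` over all available splits `(l, f)`. -/
def bestSplits (B : TieBreak 𝒳 c) (F : Finset (𝒳 → Bool)) (C γ : ℝ) (D : Dataset 𝒳 c n)
    (T : DTree 𝒳 c) : Finset (List Bool × (𝒳 → Bool)) :=
  (candidates F T).filter fun q => ∀ q' ∈ candidates F T,
    splitFun C γ D (split B D T q.1 q.2) ≤ splitFun C γ D (split B D T q'.1 q'.2)

/-- One round of the top-down learner. -/
def growStep (B : TieBreak 𝒳 c) (F : Finset (𝒳 → Bool)) (C γ : ℝ) (D : Dataset 𝒳 c n)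
    (T : DTree 𝒳 c) : DTree 𝒳 c :=
  split B D T (B.pickSplit T (bestSplits B F C γ D T)).1 (B.pickSplit T (bestSplits B F C γ D T)).2

/-- The tree with `t` internal nodes returned by the top-down learner: start from a single leaf
labeled by the most frequent label, then make `t` greedy splits. -/
def learn (B : TieBreak 𝒳 c) (F : Finset (𝒳 → Bool)) (C γ : ℝ) (t : ℕ) (D : Dataset 𝒳 c n) :
    DTree 𝒳 c :=
  (growStep B F C γ D)^[t] (DTree.leaf (majority B D Finset.univ))

/-- The 0-1 loss `L(T, D)`: the fraction of examples of `D` that `T` misclassifies. -/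
def zeroOneLoss (T : DTree 𝒳 c) (D : Dataset 𝒳 c n) : ℝ :=
  (1 / (n : ℝ)) * ∑ i, if T.predict (D i).1 ≠ (D i).2 then (1 : ℝ) else 0

/-- The loss on `D` of the tree learned on `D` with parameter `γ`. -/
def paramLoss (B : TieBreak 𝒳 c) (F : Finset (𝒳 → Bool)) (C : ℝ) (t : ℕ) (γ : ℝ)
    (D : Dataset 𝒳 c n) : ℝ :=
  zeroOneLoss (learn B F C γ t D) D

/-- `γ` is an output of empirical risk minimization over `(0, 1]` on the problem sample `S`. -/
def IsERM (B : TieBreak 𝒳 c) (F : Finset (𝒳 → Bool)) (C : ℝ) (t : ℕ) {N : ℕ}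
    (S : Fin N → Dataset 𝒳 c n) (γ : ℝ) : Prop :=
  γ ∈ Set.Ioc (0 : ℝ) 1 ∧ ∀ γ' ∈ Set.Ioc (0 : ℝ) 1,
    ∑ j, paramLoss B F C t γ (S j) ≤ ∑ j, paramLoss B F C t γ' (S j)

/-- The expected loss of the parameter `γ` over the distribution `P` on problem instances. -/
def expectedLoss [MeasurableSpace 𝒳] (B : TieBreak 𝒳 c) (F : Finset (𝒳 → Bool)) (C : ℝ) (t : ℕ)
    (P : MeasureTheory.Measure (Dataset 𝒳 c n)) (γ : ℝ) : ℝ :=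
  ∫ D, paramLoss B F C t γ D ∂P

/-- The expected loss of `γ` exceeds that of no parameter in `(0, 1]` by more than `ε`. -/
def IsEpsOptimal [MeasurableSpace 𝒳] (B : TieBreak 𝒳 c) (F : Finset (𝒳 → Bool)) (C : ℝ) (t : ℕ)
    (P : MeasureTheory.Measure (Dataset 𝒳 c n)) (ε γ : ℝ) : Prop :=
  ∀ γ' ∈ Set.Ioc (0 : ℝ) 1, expectedLoss B F C t P γ ≤ expectedLoss B F C t P γ' + ε

end

end TopDown

section

open MeasureTheory Finset

/-! Part (b): splitting a leaf changes only that leaf's contribution to `G_γ`, so the difference of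
two splitting functions is a sum of six terms `a * b ^ γ` with `b ≥ 0`. By Rolle and induction, an
exponential sum with `m` terms and `m` distinct zeros vanishes identically
(`expSum_eq_zero_of_zeros`), which gives `K = 5`.

Part (a): for a fixed dataset, at most `(t * |F|) ^ t` trees are reachable in each round before the
last, whatever `γ` is. By (b) and the intermediate value theorem, the greedy choices can change only
at `5 * (t * |F|) ^ (t + 3)` parameters. Hence the loss depends on `γ` only through the position of
`γ` among these breakpoints, an integer `V γ D ≤ M` that is monotone in `γ`
(`paramLoss_eq_of_relativeRank_eq`).

Monotonicity gives uniform convergence at rate `√(log (M / δ) / N)` by chaining with brackets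
(`measureReal_exists_deviation_gt_le`). Parameters are grouped by the mean of `V` at scale `2⁻ᵏ`,
which makes at most `M * 2 ^ k + 1` groups. Two members of a group have equal loss outside an event
of probability at most `2⁻ᵏ`, as `V` is integer-valued and monotone. A Bernstein bound with this
small variance controls each link. At the finest scale the disagreement indicator of a whole group
bounds the remainder. Finally, a uniform deviation of at most `ε / 2` makes every ERM parameter
`ε`-optimal. -/

/-! ### Zeros of real exponential sums. -/

theorem exists_strictMono_deriv_eq_zero {g g' : ℝ → ℝ} (hg : ∀ x, HasDerivAt g (g' x) x) {m : ℕ}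
    (x : Fin (m + 1) → ℝ) (hx : StrictMono x) (h0 : ∀ i, g (x i) = 0) :
    ∃ y : Fin m → ℝ, StrictMono y ∧ ∀ i, g' (y i) = 0 := by
  have h : ∀ i : Fin m, ∃ y, y ∈ Set.Ioo (x i.castSucc) (x i.succ) ∧ g' y = 0 := by
    intro i
    obtain ⟨y, hy, hy'⟩ := exists_hasDerivAt_eq_zero (f := g) (f' := g') (hx i.castSucc_lt_succ)
      (fun z _ => (hg z).continuousAt.continuousWithinAt) (by rw [h0, h0]) (fun z _ => hg z)
    exact ⟨y, hy, hy'⟩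
  choose y hy hy' using h
  refine ⟨y, fun i j hij => ?_, hy'⟩
  have : x i.succ ≤ x j.castSucc := hx.monotone (by
    rw [Fin.le_def]; simpa using hij)
  exact (hy i).2.trans_le (this.trans (hy j).1.le)

/-- Dividing by `exp (l 0 * z)` makes one term constant, and differentiation removes it. Rolle costs
one zero, so the induction hypothesis applies to the derivative, and the quotient is a constant with
a zero. The exponents need not be distinct. -/
theorem expSum_eq_zero_of_zeros (m : ℕ) : ∀ (a l : Fin m → ℝ) (x : Fin m → ℝ), StrictMono x →
    (∀ j, ∑ i, a i * Real.exp (l i * x j) = 0) → ∀ z, ∑ i, a i * Real.exp (l i * z) = 0 := by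
  induction m with
  | zero => intros; simp
  | succ m ih =>
    intro a l x hx h0 z
    set g : ℝ → ℝ := fun z =>
      a 0 + ∑ i : Fin m, a i.succ * Real.exp ((l i.succ - l 0) * z) with hgdef
    have key : ∀ z, ∑ i, a i * Real.exp (l i * z) = Real.exp (l 0 * z) * g z := by
      intro z
      rw [Fin.sum_univ_succ, hgdef]
      simp only [mul_add, mul_sum]
      congr 1
      · ring
      · refine sum_congr rfl fun i _ => ?_
        rw [mul_left_comm, ← Real.exp_add]
        ring_nf
    have hg : ∀ z, HasDerivAt g
        (∑ i : Fin m, (a i.succ * (l i.succ - l 0)) * Real.exp ((l i.succ - l 0) * z)) z := by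
      intro z
      refine HasDerivAt.const_add _ (HasDerivAt.fun_sum fun i _ => ?_)
      have := (((hasDerivAt_id z).const_mul (l i.succ - l 0)).exp).const_mul (a i.succ)
      refine this.congr_deriv ?_
      simp only [id_eq]
      ring
    have hg0 : ∀ j, g (x j) = 0 := by
      intro j
      have := h0 j
      rw [key] at this
      exact (mul_eq_zero.1 this).resolve_left (Real.exp_ne_zero _)
    obtain ⟨y, hy, hy'⟩ := exists_strictMono_deriv_eq_zero hg x hx hg0
    have hd := ih _ _ y hy hy'
    have hc : g z = g (x 0) := by
      refine is_const_of_deriv_eq_zero (fun z => (hg z).differentiableAt) (fun z => ?_) _ _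
      rw [(hg z).deriv, hd]
    rw [key, hc, hg0, mul_zero]

theorem encard_zeros_rpowSum_le {m : ℕ} (a b : Fin (m + 1) → ℝ) (hb : ∀ i, 0 ≤ b i) :
    (∀ γ ∈ Set.Ioc (0 : ℝ) 1, ∑ i, a i * b i ^ γ = 0) ∨
      {γ ∈ Set.Ioc (0 : ℝ) 1 | ∑ i, a i * b i ^ γ = 0}.encard ≤ m := by
  rw [or_iff_not_imp_right, not_le]
  intro h γ hγ
  -- A zero base contributes `0 ^ γ = 0` because `γ > 0`. Its coefficient is set to `0`, since `exp
  -- (log 0 * γ) = 1` would be wrong.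
  have key : ∀ γ ∈ Set.Ioc (0 : ℝ) 1, ∑ i, a i * b i ^ γ =
      ∑ i, (if b i = 0 then 0 else a i) * Real.exp (Real.log (b i) * γ) := by
    intro γ hγ
    refine sum_congr rfl fun i _ => ?_
    split_ifs with hi
    · rw [hi, Real.zero_rpow hγ.1.ne']; simp
    · rw [Real.rpow_def_of_pos ((hb i).lt_of_ne' hi)]
  have h' : ((m + 1 : ℕ) : ℕ∞) ≤
      {γ ∈ Set.Ioc (0 : ℝ) 1 | ∑ i, a i * b i ^ γ = 0}.encard := by
    push_cast
    exact Order.add_one_le_of_lt h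
  obtain ⟨s, hs, hcard⟩ := Set.exists_subset_encard_eq h'
  have hfin : s.Finite := Set.finite_of_encard_eq_coe hcard
  lift s to Finset ℝ using hfin
  have hc : s.card = m + 1 := by
    rw [Set.encard_coe_eq_coe_finsetCard] at hcard
    exact_mod_cast hcard
  rw [key γ hγ]
  refine expSum_eq_zero_of_zeros (m + 1) _ _ (s.orderEmbOfFin hc) (s.orderEmbOfFin hc).strictMono
    (fun j => ?_) γ
  have hj := hs (s.orderEmbOfFin_mem hc j)
  rw [← key _ hj.1]
  exact hj.2

/-! ### The effect of a split on `G_γ`, and part (b). -/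

namespace TopDown
namespace DTree
variable {𝒳 : Type u} {c : ℕ}

theorem leafOf_mem_leaves (T : DTree 𝒳 c) (x : 𝒳) : T.leafOf x ∈ T.leaves := by
  induction T with
  | leaf y => simp [leafOf, leaves]
  | node f l r ihl ihr => by_cases h : f x <;> simp [leafOf, leaves, h, ihl, ihr]

theorem leaves_nonempty (T : DTree 𝒳 c) : T.leaves.Nonempty := by
  induction T with
  | leaf y => simp [leaves]
  | node f l r ihl ihr => simp [leaves, ihl]

theorem leaves_replaceLeaf (T : DTree 𝒳 c) (a : List Bool) (f : 𝒳 → Bool) (y₀ y₁ : Fin c)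
    (ha : a ∈ T.leaves) :
    (T.replaceLeaf a f y₀ y₁).leaves = T.leaves.erase a ∪ {a ++ [false], a ++ [true]} := by
  induction T generalizing a with
  | leaf y =>
    obtain rfl : a = [] := by simpa [leaves] using ha
    ext b; simp [replaceLeaf, leaves]
  | node g l r ihl ihr =>
    rcases a with _ | ⟨_ | _, a⟩
    · simp [leaves] at ha
    · have ha' : a ∈ l.leaves := by simpa [leaves] using ha
      ext b
      rcases b with _ | ⟨_ | _, b⟩ <;> simp [replaceLeaf, leaves, ihl a ha']
    · have ha' : a ∈ r.leaves := by simpa [leaves] using ha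
      ext b
      rcases b with _ | ⟨_ | _, b⟩ <;> simp [replaceLeaf, leaves, ihr a ha']

theorem append_singleton_notMem_leaves (T : DTree 𝒳 c) (a : List Bool) (b : Bool)
    (ha : a ∈ T.leaves) : a ++ [b] ∉ T.leaves := by
  induction T generalizing a with
  | leaf y =>
    simp [leaves]
  | node g l r ihl ihr =>
    rcases a with _ | ⟨_ | _, a⟩
    · simp [leaves] at ha
    · have ha' : a ∈ l.leaves := by simpa [leaves] using ha
      simp [leaves, ihl a ha']
    · have ha' : a ∈ r.leaves := by simpa [leaves] using ha
      simp [leaves, ihr a ha']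

theorem leafOf_replaceLeaf (T : DTree 𝒳 c) (a : List Bool) (f : 𝒳 → Bool) (y₀ y₁ : Fin c)
    (ha : a ∈ T.leaves) (x : 𝒳) :
    (T.replaceLeaf a f y₀ y₁).leafOf x =
      if T.leafOf x = a then a ++ [f x] else T.leafOf x := by
  induction T generalizing a with
  | leaf y =>
    obtain rfl : a = [] := by simpa [leaves] using ha
    by_cases h : f x <;> simp [replaceLeaf, leafOf, h]
  | node g l r ihl ihr =>
    rcases a with _ | ⟨_ | _, a⟩
    · simp [leaves] at ha
    · have ha' : a ∈ l.leaves := by simpa [leaves] using ha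
      by_cases h : g x <;> simp [replaceLeaf, leafOf, h, ihl a ha']
      split_ifs <;> simp
    · have ha' : a ∈ r.leaves := by simpa [leaves] using ha
      by_cases h : g x <;> simp [replaceLeaf, leafOf, h, ihr a ha']
      split_ifs <;> simp

end DTree

noncomputable section
variable {𝒳 : Type u} {c n : ℕ}

/-- The contribution to `G_γ` of a leaf to which the examples with index in `s` are mapped. -/
def groupTerm (C γ : ℝ) (D : Dataset 𝒳 c n) (s : Finset (Fin n)) : ℝ :=
  (s.card : ℝ) * splitCriterion C γ fun k => (labelCount D s k : ℝ) / (s.card : ℝ)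

theorem splitFun_eq_sum_groupTerm (C γ : ℝ) (D : Dataset 𝒳 c n) (T : DTree 𝒳 c) :
    splitFun C γ D T = ∑ a ∈ T.leaves, groupTerm C γ D (points D T a) := rfl

theorem splitFun_split (B : TieBreak 𝒳 c) (C γ : ℝ) (D : Dataset 𝒳 c n) (T : DTree 𝒳 c)
    (a : List Bool) (f : 𝒳 → Bool) (ha : a ∈ T.leaves) :
    splitFun C γ D (split B D T a f) = splitFun C γ D T - groupTerm C γ D (points D T a) +
      (groupTerm C γ D ((points D T a).filter fun i => f (D i).1 = false) +
       groupTerm C γ D ((points D T a).filter fun i => f (D i).1 = true)) := by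
  have h0 := T.append_singleton_notMem_leaves a false ha
  have h1 := T.append_singleton_notMem_leaves a true ha
  rw [splitFun_eq_sum_groupTerm, splitFun_eq_sum_groupTerm, split,
    DTree.leaves_replaceLeaf _ _ _ _ _ ha, sum_union, sum_pair, ← add_sum_erase _ _ ha,
    add_sub_cancel_left]
  · congr 1
    · refine sum_congr rfl fun b hb => ?_
      congr 1
      ext i
      simp only [points, mem_filter, mem_univ, true_and, DTree.leafOf_replaceLeaf _ _ _ _ _ ha]
      split_ifs with h
      · rw [mem_erase] at hb
        rw [h]
        refine iff_of_false (fun e => ?_) (Ne.symm hb.1)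
        cases hf : f (D i).1 <;> rw [hf] at e <;> rw [← e] at hb
        · exact h0 hb.2
        · exact h1 hb.2
      · rfl
    · congr 2 <;> ext i <;>
      · simp only [points, mem_filter, mem_univ, true_and, DTree.leafOf_replaceLeaf _ _ _ _ _ ha]
        split_ifs with h
        · simp [h]
        · refine iff_of_false (fun e => ?_) (fun e => h e.1)
          have := T.leafOf_mem_leaves (D i).1
          rw [e] at this
          first | exact h0 this | exact h1 this
  · simp
  · rw [Finset.disjoint_right]
    intro b hb
    simp only [mem_insert, mem_singleton] at hb
    rcases hb with rfl | rfl <;> simp [h0, h1]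

theorem continuousOn_groupTerm (C : ℝ) (D : Dataset 𝒳 c n) (s : Finset (Fin n)) :
    ContinuousOn (fun γ => groupTerm C γ D s) (Set.Ioi 0) := by
  unfold groupTerm splitCriterion
  refine continuousOn_const.mul (continuousOn_const.mul fun γ hγ => ?_)
  exact (Real.continuousAt_const_rpow' (ne_of_gt hγ)).continuousWithinAt

/-- By `splitFun_split` the common value of `G_γ` on `T` cancels. Each side keeps three terms: the
split leaf and its two children. -/
theorem encard_eq_splitFun_le (B : TieBreak 𝒳 c) (C : ℝ) (D : Dataset 𝒳 c n) (T : DTree 𝒳 c)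
    (a₁ a₂ : List Bool) (f₁ f₂ : 𝒳 → Bool) (h₁ : a₁ ∈ T.leaves) (h₂ : a₂ ∈ T.leaves) :
    (∀ γ ∈ Set.Ioc (0 : ℝ) 1, splitFun C γ D (split B D T a₁ f₁) =
      splitFun C γ D (split B D T a₂ f₂)) ∨
    {γ ∈ Set.Ioc (0 : ℝ) 1 | splitFun C γ D (split B D T a₁ f₁) =
      splitFun C γ D (split B D T a₂ f₂)}.encard ≤ 5 := by
  let s : Fin 6 → Finset (Fin n) := ![points D T a₁,
    (points D T a₁).filter fun i => f₁ (D i).1 = false,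
    (points D T a₁).filter fun i => f₁ (D i).1 = true, points D T a₂,
    (points D T a₂).filter fun i => f₂ (D i).1 = false,
    (points D T a₂).filter fun i => f₂ (D i).1 = true]
  let σ : Fin 6 → ℝ := ![-1, 1, 1, 1, -1, -1]
  have key : ∀ γ, (splitFun C γ D (split B D T a₁ f₁) = splitFun C γ D (split B D T a₂ f₂)) ↔
      ∑ i, (σ i * (s i).card * C) * (∏ k, (labelCount D (s i) k : ℝ) / ((s i).card : ℝ)) ^ γ
        = 0 := by
    intro γ
    rw [splitFun_split _ _ _ _ _ _ _ h₁, splitFun_split _ _ _ _ _ _ _ h₂]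
    have : ∑ i, (σ i * (s i).card * C) *
        (∏ k, (labelCount D (s i) k : ℝ) / ((s i).card : ℝ)) ^ γ =
        ∑ i, σ i * groupTerm C γ D (s i) :=
      sum_congr rfl fun i _ => by unfold groupTerm splitCriterion; ring
    rw [this, ← sub_eq_zero]
    simp only [Fin.sum_univ_six, s, σ, Matrix.cons_val]
    ring_nf
  simp only [key]
  exact encard_zeros_rpowSum_le _ _ fun i => prod_nonneg fun k _ => by positivity

end
end TopDown

/-! ### A Bernstein inequality for independent samples. -/

theorem integral_exp_mul_le {Ω : Type*} [MeasurableSpace Ω] (P : Measure Ω)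
    [IsProbabilityMeasure P] {X : Ω → ℝ} (hX : Measurable X) (hb : ∀ ω, |X ω| ≤ 1) {v l : ℝ}
    (hv : ∫ ω, X ω ^ 2 ∂P ≤ v) (hl : 0 ≤ l) (hl1 : l ≤ 1) :
    ∫ ω, Real.exp (l * X ω) ∂P ≤ Real.exp (l * ∫ ω, X ω ∂P + l ^ 2 * v) := by
  have hi : Integrable X P := .of_bound hX.aestronglyMeasurable 1 (.of_forall hb)
  have hi2 : Integrable (fun ω => X ω ^ 2) P :=
    .of_bound (hX.pow_const 2).aestronglyMeasurable 1 (.of_forall fun ω => by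
      rw [norm_pow]; exact pow_le_one₀ (norm_nonneg _) (hb ω))
  -- The inequality `exp u ≤ 1 + u + u ^ 2` needs `|u| ≤ 1`, hence the restriction `l ≤ 1`.
  have hpt : ∀ ω, Real.exp (l * X ω) ≤ 1 + l * X ω + l ^ 2 * X ω ^ 2 := by
    intro ω
    have h1 : |l * X ω| ≤ 1 := by
      rw [abs_mul, abs_of_nonneg hl]; exact mul_le_one₀ hl1 (abs_nonneg _) (hb ω)
    have := (abs_le.1 (Real.abs_exp_sub_one_sub_id_le h1)).2
    rw [mul_pow] at this
    linarith
  have hint : Integrable (fun ω => 1 + l * X ω + l ^ 2 * X ω ^ 2) P :=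
    ((integrable_const 1).add (hi.const_mul l)).add (hi2.const_mul (l ^ 2))
  calc ∫ ω, Real.exp (l * X ω) ∂P ≤ ∫ ω, (1 + l * X ω + l ^ 2 * X ω ^ 2) ∂P :=
        integral_mono_of_nonneg (.of_forall fun ω => (Real.exp_pos _).le) hint (.of_forall hpt)
    _ = 1 + l * ∫ ω, X ω ∂P + l ^ 2 * ∫ ω, X ω ^ 2 ∂P := by
        rw [integral_add (f := fun ω => 1 + l * X ω) ((integrable_const 1).add (hi.const_mul l))
          (hi2.const_mul (l ^ 2)), integral_add (integrable_const 1) (hi.const_mul l),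
          integral_const_mul, integral_const_mul]
        simp
    _ ≤ 1 + l * ∫ ω, X ω ∂P + l ^ 2 * v := by gcongr
    _ ≤ _ := by
        have := Real.add_one_le_exp (l * ∫ ω, X ω ∂P + l ^ 2 * v)
        linarith

/-- The deviation of the sum of `X` over a sample from its expected value. -/
noncomputable def deviation {Ω : Type*} [MeasurableSpace Ω] (P : Measure Ω) {N : ℕ}
    (S : Fin N → Ω) (X : Ω → ℝ) : ℝ := ∑ j, X (S j) - N * ∫ ω, X ω ∂P

section Deviation
variable {Ω : Type*} [MeasurableSpace Ω] (P : Measure Ω) {N : ℕ}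

theorem deviation_sub (S : Fin N → Ω) {X Y : Ω → ℝ} (hX : Integrable X P) (hY : Integrable Y P) :
    deviation P S (fun ω => X ω - Y ω) = deviation P S X - deviation P S Y := by
  simp only [deviation, sum_sub_distrib, integral_sub hX hY]
  ring

theorem deviation_neg (S : Fin N → Ω) (X : Ω → ℝ) :
    deviation P S (fun ω => - X ω) = - deviation P S X := by
  simp only [deviation, sum_neg_distrib, integral_neg]
  ring

theorem measureReal_le_deviation_le (N : ℕ) [IsProbabilityMeasure P] {X : Ω → ℝ}
    (hX : Measurable X) (hb : ∀ ω, |X ω| ≤ 1) {v s : ℝ} (hv0 : 0 < v)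
    (hv : ∫ ω, X ω ^ 2 ∂P ≤ v) (hs : 0 ≤ s) (hsv : s ≤ 2 * v) :
    (Measure.pi fun _ : Fin N => P).real {S | N * s ≤ deviation P S X} ≤
      Real.exp (-(N * s ^ 2 / (4 * v))) := by
  -- This minimizes the Chernoff exponent `-l * s + l ^ 2 * v`. The assumption `s ≤ 2 * v` says
  -- exactly that `l ≤ 1`.
  set l := s / (2 * v) with hl
  have hl0 : 0 ≤ l := by positivity
  have hl1 : l ≤ 1 := by rw [hl, div_le_one (by positivity)]; exact hsv
  have hfm : Measurable fun ω => Real.exp (l * X ω) := (hX.const_mul l).exp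
  have hfi : Integrable (fun ω => Real.exp (l * X ω)) P :=
    .of_bound hfm.aestronglyMeasurable (Real.exp 1) (.of_forall fun ω => by
      rw [Real.norm_eq_abs, Real.abs_exp, Real.exp_le_exp]
      have : l * X ω ≤ |l * X ω| := le_abs_self _
      rw [abs_mul, abs_of_nonneg hl0] at this
      exact this.trans (mul_le_one₀ hl1 (abs_nonneg _) (hb ω)))
  have hmk := mul_meas_ge_le_integral_of_nonneg (μ := Measure.pi fun _ : Fin N => P)
    (f := fun S => ∏ j, Real.exp (l * X (S j)))
    (.of_forall fun S => prod_nonneg fun j _ => (Real.exp_pos _).le)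
    (Integrable.fintype_prod fun _ => hfi) (Real.exp (l * (N * s + N * ∫ ω, X ω ∂P)))
  rw [integral_fintype_prod_eq_pow (fun ω => Real.exp (l * X ω)), Fintype.card_fin] at hmk
  have hset : {S : Fin N → Ω | Real.exp (l * (N * s + N * ∫ ω, X ω ∂P)) ≤
      ∏ j, Real.exp (l * X (S j))} ⊇ {S | N * s ≤ deviation P S X} := by
    intro S hS
    simp only [Set.mem_ofPred_eq, deviation] at hS ⊢
    rw [← Real.exp_sum, Real.exp_le_exp, ← mul_sum]
    gcongr
    linarith
  have h1 := measureReal_mono hset (measure_ne_top (Measure.pi fun _ : Fin N => P) _)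
  have h2 : (∫ ω, Real.exp (l * X ω) ∂P) ^ N ≤
      Real.exp (N * (l * ∫ ω, X ω ∂P + l ^ 2 * v)) := by
    rw [Real.exp_nat_mul]
    exact pow_le_pow_left₀ (integral_nonneg fun ω => (Real.exp_pos _).le)
      (integral_exp_mul_le P hX hb hv hl0 hl1) N
  have h3 := (mul_le_mul_of_nonneg_left h1 (Real.exp_pos _).le).trans (hmk.trans h2)
  rw [← le_div_iff₀' (Real.exp_pos _), ← Real.exp_sub] at h3
  refine h3.trans (Real.exp_le_exp.2 (le_of_eq ?_))
  rw [hl]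
  field_simp
  ring

theorem measureReal_le_abs_deviation_le (N : ℕ) [IsProbabilityMeasure P] {X : Ω → ℝ}
    (hX : Measurable X) (hb : ∀ ω, |X ω| ≤ 1) {v s : ℝ} (hv0 : 0 < v)
    (hv : ∫ ω, X ω ^ 2 ∂P ≤ v) (hs : 0 ≤ s) (hsv : s ≤ 2 * v) :
    (Measure.pi fun _ : Fin N => P).real {S | N * s ≤ |deviation P S X|} ≤
      2 * Real.exp (-(N * s ^ 2 / (4 * v))) := by
  have h1 := measureReal_le_deviation_le P N hX hb hv0 hv hs hsv
  have h2 := measureReal_le_deviation_le P N hX.neg (X := fun ω => - X ω)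
    (fun ω => by rw [abs_neg]; exact hb ω) hv0 (by simpa using hv) hs hsv
  have hset : {S : Fin N → Ω | N * s ≤ |deviation P S X|} ⊆ {S | N * s ≤ deviation P S X} ∪
      {S | N * s ≤ deviation P S fun ω => - X ω} := by
    intro S hS
    simp only [Set.mem_ofPred_eq, Set.mem_union, deviation_neg] at hS ⊢
    exact le_abs.1 hS
  have := (measureReal_mono hset
    (measure_ne_top (Measure.pi fun _ : Fin N => P) _)).trans (measureReal_union_le _ _)
  linarith

end Deviation

/-! ### Chaining over a family indexed by a monotone integer variable. -/

section Buckets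
variable {ι : Type*} [Fintype ι] [LinearOrder ι]

/-- The least index with the same bucket as `i`. -/
def bucketMin (b : ι → ℕ) (i : ι) : ι :=
  ({j | b j = b i} : Finset ι).min' ⟨i, by simp⟩

/-- The greatest index with the same bucket as `i`. -/
def bucketMax (b : ι → ℕ) (i : ι) : ι :=
  ({j | b j = b i} : Finset ι).max' ⟨i, by simp⟩

theorem apply_bucketMin (b : ι → ℕ) (i : ι) : b (bucketMin b i) = b i :=
  (Finset.mem_filter.1 (Finset.min'_mem ({j | b j = b i} : Finset ι) ⟨i, by simp⟩)).2

theorem apply_bucketMax (b : ι → ℕ) (i : ι) : b (bucketMax b i) = b i :=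
  (Finset.mem_filter.1 (Finset.max'_mem ({j | b j = b i} : Finset ι) ⟨i, by simp⟩)).2

theorem bucketMin_le (b : ι → ℕ) {i j : ι} (h : b i = b j) : bucketMin b i ≤ j :=
  Finset.min'_le _ _ (by simp [h])

theorem le_bucketMax (b : ι → ℕ) {i j : ι} (h : b i = b j) : j ≤ bucketMax b i :=
  Finset.le_max' _ _ (by simp [h])

theorem card_image_bucketMin_le (b : ι → ℕ) {R : ℕ} (h : ∀ i, b i ≤ R) :
    (univ.image (bucketMin b)).card ≤ R + 1 := by
  calc _ ≤ (Finset.range (R + 1)).card := by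
        refine Finset.card_le_card_of_injOn b (fun x _ => ?_) ?_
        · simpa [Nat.lt_succ_iff] using h x
        · intro x hx y hy hxy
          simp only [coe_image, coe_univ, Set.image_univ, Set.mem_range] at hx hy
          obtain ⟨i, rfl⟩ := hx
          obtain ⟨j, rfl⟩ := hy
          have hij : b i = b j := by
            rw [← apply_bucketMin b i, ← apply_bucketMin b j]; exact hxy
          simp only [bucketMin, hij]
    _ = R + 1 := card_range _

end Buckets

section Chaining
variable {Ω : Type*} [MeasurableSpace Ω] (P : Measure Ω) {ι : Type*}

/-- The dyadic bucket, at scale `2⁻ᵏ`, of the expected value of `V i`. -/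
noncomputable def meanBucket (V : ι → Ω → ℕ) (k : ℕ) (i : ι) : ℕ :=
  ⌊2 ^ k * ∫ ω, (V i ω : ℝ) ∂P⌋₊

variable [IsProbabilityMeasure P] {V : ι → Ω → ℕ} {M : ℕ}

theorem integrable_natCast (hVm : ∀ i, Measurable (V i)) (hM : ∀ i ω, V i ω ≤ M) (i : ι) :
    Integrable (fun ω => (V i ω : ℝ)) P :=
  .of_bound (measurable_from_nat.comp (hVm i)).aestronglyMeasurable M (.of_forall fun ω => by
    simpa using hM i ω)

theorem meanBucket_le (hVm : ∀ i, Measurable (V i)) (hM : ∀ i ω, V i ω ≤ M) (k : ℕ) (i : ι) :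
    meanBucket P V k i ≤ M * 2 ^ k := by
  refine Nat.floor_le_of_le ?_
  have : ∫ ω, (V i ω : ℝ) ∂P ≤ ∫ _, (M : ℝ) ∂P :=
    integral_mono (integrable_natCast P hVm hM i) (integrable_const _)
      fun ω => Nat.cast_le.2 (hM i ω)
  simp only [integral_const, probReal_univ, one_smul] at this
  push_cast
  rw [mul_comm]
  gcongr

/-- For integers with `V i ≤ V j`, the indicator of `V i ≠ V j` is at most `V j - V i`. The means of
the two differ by at most `2⁻ᵏ` within a bucket. -/
theorem integral_indicator_ne_le [LinearOrder ι] (hVm : ∀ i, Measurable (V i))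
    (hM : ∀ i ω, V i ω ≤ M) (hV : ∀ ω, Monotone fun i => V i ω) (k : ℕ) {i j : ι} (hij : i ≤ j)
    (hb : meanBucket P V k i = meanBucket P V k j) :
    ∫ ω, (if V i ω = V j ω then (0 : ℝ) else 1) ∂P ≤ (1 / 2) ^ k := by
  have hi := integrable_natCast P hVm hM i
  have hj := integrable_natCast P hVm hM j
  calc ∫ ω, (if V i ω = V j ω then (0 : ℝ) else 1) ∂P
      ≤ ∫ ω, ((V j ω : ℝ) - V i ω) ∂P := by
        refine integral_mono_of_nonneg (.of_forall fun ω => ?_) (hj.sub hi) (.of_forall fun ω => ?_)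
        · simp only [Pi.zero_apply]; split_ifs <;> norm_num
        · have h := hV ω hij
          simp only at h ⊢
          split_ifs with he
          · rw [he, sub_self]
          · have : V i ω + 1 ≤ V j ω := lt_of_le_of_ne h he
            have : (V i ω : ℝ) + 1 ≤ V j ω := by exact_mod_cast this
            linarith
    _ = ∫ ω, (V j ω : ℝ) ∂P - ∫ ω, (V i ω : ℝ) ∂P := integral_sub hj hi
    _ ≤ (1 / 2) ^ k := by
        have h1 : (meanBucket P V k i : ℝ) ≤ 2 ^ k * ∫ ω, (V i ω : ℝ) ∂P :=
          Nat.floor_le (mul_nonneg (by positivity) (integral_nonneg fun ω => by positivity))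
        have h2 : 2 ^ k * ∫ ω, (V j ω : ℝ) ∂P < (meanBucket P V k j : ℝ) + 1 :=
          Nat.lt_floor_add_one _
        rw [hb] at h1
        rw [one_div, inv_pow, ← one_div, le_div_iff₀ (by positivity)]
        linarith

end Chaining

/-- This makes the failure probabilities of the levels summable. By Bernoulli, `16 * (9 / 8) ^ k ≥
16 + 2 * k`. One factor `exp (-Λ)` pays for `M`, and the others, each at most `1 / 2`, beat the `2 ^
k` growth of the number of buckets. -/
theorem level_tail_le {k : ℕ} {M δ Λ E : ℝ} (hM : 0 < M) (hδ : 0 ≤ δ) (hΛ : 0 ≤ Λ)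
    (h1 : Real.exp (-Λ) ≤ δ / M) (h2 : Real.exp (-Λ) ≤ 1 / 2)
    (hE : 16 * Λ * (9 / 8) ^ k ≤ E) :
    4 * M * 2 ^ k * Real.exp (-E) ≤ δ * (1 / 4) * (1 / 2) ^ k := by
  have hk : (1 : ℝ) + k * (1 / 8) ≤ (9 / 8) ^ k := by
    have := one_add_mul_le_pow (a := (1 / 8 : ℝ)) (by norm_num) k
    norm_num at this ⊢
    exact this
  have hE' : ((16 + 2 * k : ℕ) : ℝ) * Λ ≤ E := by
    push_cast
    have := mul_le_mul_of_nonneg_left hk hΛ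
    linarith
  have h3 : Real.exp (-E) ≤ Real.exp (-Λ) ^ (16 + 2 * k) := by
    rw [← Real.exp_nat_mul, Real.exp_le_exp]; linarith
  have h4 : Real.exp (-Λ) ^ (16 + 2 * k) ≤ δ / M * (1 / 2) ^ (15 + 2 * k) := by
    rw [show 16 + 2 * k = (15 + 2 * k) + 1 by ring, pow_succ, mul_comm]
    gcongr
  calc 4 * M * 2 ^ k * Real.exp (-E) ≤ 4 * M * 2 ^ k * (δ / M * (1 / 2) ^ (15 + 2 * k)) := by
        gcongr; exact h3.trans h4
    _ = δ * (4 * (1 / 2) ^ 15) * ((2 * (1 / 2) * (1 / 2)) ^ k) := by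
        rw [mul_pow, mul_pow, pow_add, pow_mul', sq ((1 / 2 : ℝ) ^ k)]
        field_simp
    _ ≤ _ := by norm_num; gcongr; norm_num

theorem abs_sub_le_ite {Ω ι : Type*} {V : ι → Ω → ℕ} {h : ι → Ω → ℝ}
    (h0 : ∀ i ω, 0 ≤ h i ω) (h1 : ∀ i ω, h i ω ≤ 1)
    (hVh : ∀ i j ω, V i ω = V j ω → h i ω = h j ω) (i j : ι) (ω : Ω) :
    |h i ω - h j ω| ≤ if V j ω = V i ω then 0 else 1 := by
  split_ifs with he
  · rw [hVh _ _ _ he, sub_self, abs_zero]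
  · rw [abs_le]
    constructor <;> linarith [h0 i ω, h1 i ω, h0 j ω, h1 j ω]

theorem integrable_ite_ne {Ω ι : Type*} [MeasurableSpace Ω] {P : Measure Ω}
    [IsFiniteMeasure P] {V : ι → Ω → ℕ} (hVm : ∀ i, Measurable (V i)) (i j : ι) :
    Integrable (fun ω => if V i ω = V j ω then (0 : ℝ) else 1) P :=
  .of_bound (Measurable.ite (measurableSet_eq_fun (hVm _) (hVm _)) measurable_const
    measurable_const).aestronglyMeasurable 1 (.of_forall fun ω => by split_ifs <;> simp)

section Chaining
variable {Ω : Type*} [MeasurableSpace Ω] {ι : Type*} [Fintype ι] [LinearOrder ι]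

/-- The least index whose expected value of `V` lies in the same dyadic bucket as that of `i`. -/
noncomputable def levelRep (P : Measure Ω) (V : ι → Ω → ℕ) (k : ℕ) (i : ι) : ι :=
  bucketMin (meanBucket P V k) i

/-- The link of the chain at level `k`. -/
noncomputable def chainLink (P : Measure Ω) (V : ι → Ω → ℕ) (h : ι → Ω → ℝ) : ℕ → ι → Ω → ℝ
  | 0, r => h r
  | k + 1, r => fun ω => h r ω - h (levelRep P V k r) ω

/-- The indicator of the event that `V` is not constant on the part of the bucket of `r` that is
above `r`. -/
noncomputable def bracket (P : Measure Ω) (V : ι → Ω → ℕ) (k : ℕ) (r : ι) (ω : Ω) : ℝ :=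
  if V r ω = V (bucketMax (meanBucket P V k) r) ω then 0 else 1

variable {P : Measure Ω} {V : ι → Ω → ℕ} {h : ι → Ω → ℝ} {M : ℕ}

theorem measurable_chainLink (hh : ∀ i, Measurable (h i)) (k : ℕ) (r : ι) :
    Measurable (chainLink P V h k r) := by
  cases k with
  | zero => exact hh r
  | succ k => exact (hh _).sub (hh _)

theorem measurable_bracket (hVm : ∀ i, Measurable (V i)) (k : ℕ) (r : ι) :
    Measurable (bracket P V k r) :=
  Measurable.ite (measurableSet_eq_fun (hVm _) (hVm _)) measurable_const measurable_const

theorem abs_chainLink_le (h0 : ∀ i ω, 0 ≤ h i ω) (h1 : ∀ i ω, h i ω ≤ 1) (k : ℕ) (r : ι) (ω : Ω) :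
    |chainLink P V h k r ω| ≤ 1 := by
  cases k with
  | zero =>
    rw [chainLink, abs_of_nonneg (h0 r ω)]
    exact h1 r ω
  | succ k =>
    simp only [chainLink]
    rw [abs_le]
    constructor <;> linarith [h0 r ω, h1 r ω, h0 (levelRep P V k r) ω, h1 (levelRep P V k r) ω]

/-- The chain telescopes from fine to coarse. The next representative is that of the current
representative, not of `i`, so the links at a level are indexed by the representatives of that level
alone. -/
theorem abs_deviation_levelRep_le {N : ℕ} (S : Fin N → Ω) (hh : ∀ i, Integrable (h i) P)
    {s : ℕ → ℝ} {K : ℕ}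
    (hs : ∀ k ≤ K, ∀ i, |deviation P S (chainLink P V h k (levelRep P V k i))| ≤ N * s k) :
    ∀ k ≤ K, ∀ i, |deviation P S (h (levelRep P V k i))| ≤ N * ∑ j ∈ range (k + 1), s j := by
  intro k
  induction k with
  | zero =>
    intro hk i
    simpa [chainLink] using hs 0 hk i
  | succ k ih =>
    intro hk i
    have h1 := hs _ hk i
    have h2 := ih (by omega) (levelRep P V (k + 1) i)
    have h3 := deviation_sub P S (hh (levelRep P V (k + 1) i))
      (hh (levelRep P V k (levelRep P V (k + 1) i)))
    rw [chainLink, h3] at h1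
    rw [sum_range_succ, mul_add]
    rw [abs_le] at *
    constructor <;> linarith

variable [IsProbabilityMeasure P]

/-- A link of level `k + 1` joins two indices in one bucket of level `k`, which gives `2⁻ᵏ = 2 *
2⁻⁽ᵏ⁺¹⁾`. -/
theorem integral_chainLink_sq_le (hVm : ∀ i, Measurable (V i)) (hM : ∀ i ω, V i ω ≤ M)
    (hV : ∀ ω, Monotone fun i => V i ω) (h0 : ∀ i ω, 0 ≤ h i ω) (h1 : ∀ i ω, h i ω ≤ 1)
    (hVh : ∀ i j ω, V i ω = V j ω → h i ω = h j ω) (k : ℕ) (r : ι) :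
    ∫ ω, chainLink P V h k r ω ^ 2 ∂P ≤ 2 * (1 / 2) ^ k := by
  cases k with
  | zero =>
    have : ∫ ω, chainLink P V h 0 r ω ^ 2 ∂P ≤ ∫ _, (1 : ℝ) ∂P :=
      integral_mono_of_nonneg (.of_forall fun ω => sq_nonneg _) (integrable_const _)
        (.of_forall fun ω => pow_le_one₀ (h0 r ω) (h1 r ω))
    simp only [integral_const, probReal_univ, one_smul] at this
    linarith
  | succ k =>
    have := integral_indicator_ne_le P hVm hM hV k
      (bucketMin_le (meanBucket P V k) (Eq.refl (meanBucket P V k r)))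
      (apply_bucketMin (meanBucket P V k) r)
    rw [pow_succ, mul_comm, mul_assoc]
    norm_num only
    rw [mul_one]
    refine le_trans (integral_mono_of_nonneg (.of_forall fun ω => sq_nonneg _)
      (integrable_ite_ne hVm _ _) (.of_forall fun ω => ?_)) this
    have h2 := abs_sub_le_ite h0 h1 hVh r (levelRep P V k r) ω
    simp only [chainLink]
    rw [← sq_abs]
    refine le_trans ?_ h2
    exact pow_le_of_le_one (abs_nonneg _)
      (abs_chainLink_le (P := P) (V := V) h0 h1 (k + 1) r ω) two_ne_zero

/-- If `V` agrees at both ends of the bucket, then by monotonicity it agrees at `i`, so the bracket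
dominates `|h i - h r|`. The mean of the bracket enters twice: once in the mean of the difference,
once in passing from the empirical sum of the bracket to its deviation. -/
theorem abs_deviation_le_bracket {N : ℕ} (S : Fin N → Ω) (hVm : ∀ i, Measurable (V i))
    (hM : ∀ i ω, V i ω ≤ M) (hV : ∀ ω, Monotone fun i => V i ω)
    (hh : ∀ i, Measurable (h i)) (h0 : ∀ i ω, 0 ≤ h i ω) (h1 : ∀ i ω, h i ω ≤ 1)
    (hVh : ∀ i j ω, V i ω = V j ω → h i ω = h j ω) (k : ℕ) (i : ι) :
    |deviation P S (h i)| ≤ |deviation P S (h (levelRep P V k i))| +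
      deviation P S (bracket P V k (levelRep P V k i)) + 2 * N * (1 / 2) ^ k := by
  set r := levelRep P V k i with hr
  have hri : meanBucket P V k r = meanBucket P V k i := apply_bucketMin (meanBucket P V k) i
  have hle : r ≤ i := bucketMin_le (meanBucket P V k) (Eq.refl (meanBucket P V k i))
  have hle' : i ≤ bucketMax (meanBucket P V k) r := le_bucketMax _ hri
  have hpt : ∀ ω, |h i ω - h r ω| ≤ bracket P V k r ω := by
    intro ω
    refine (abs_sub_le_ite h0 h1 hVh i r ω).trans ?_
    unfold bracket
    have h2 := hV ω hle
    have h3 := hV ω hle'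
    simp only at h2 h3
    split_ifs <;> first | omega | norm_num
  have hint : ∀ i, Integrable (h i) P := fun i =>
    .of_bound (hh i).aestronglyMeasurable 1 (.of_forall fun ω => by
      rw [Real.norm_eq_abs, abs_of_nonneg (h0 i ω)]; exact h1 i ω)
  have hB : Integrable (bracket P V k r) P := integrable_ite_ne hVm _ _
  have hBi : ∫ ω, bracket P V k r ω ∂P ≤ (1 / 2) ^ k :=
    integral_indicator_ne_le P hVm hM hV k (hle.trans hle') (apply_bucketMax _ _).symm
  have hsum : |∑ j, (h i (S j) - h r (S j))| ≤ ∑ j, bracket P V k r (S j) :=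
    (abs_sum_le_sum_abs _ _).trans (sum_le_sum fun j _ => hpt _)
  have hI : |∫ ω, (h i ω - h r ω) ∂P| ≤ ∫ ω, bracket P V k r ω ∂P :=
    (abs_integral_le_integral_abs).trans
      (integral_mono ((hint i).sub (hint r)).abs hB hpt)
  have hd := deviation_sub P S (hint i) (hint r)
  have hN : (0 : ℝ) ≤ N := Nat.cast_nonneg N
  have h4 : |deviation P S (fun ω => h i ω - h r ω)| ≤ ∑ j, bracket P V k r (S j) +
      N * ∫ ω, bracket P V k r ω ∂P := by
    unfold deviation
    refine (abs_sub _ _).trans (add_le_add hsum ?_)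
    rw [abs_mul, abs_of_nonneg hN]
    gcongr
  have h5 : |deviation P S (h i)| ≤
      |deviation P S (h r)| + |deviation P S (h i) - deviation P S (h r)| := by
    have := abs_add_le (deviation P S (h r)) (deviation P S (h i) - deviation P S (h r))
    rwa [add_sub_cancel] at this
  rw [hd] at h4
  have h6 := mul_le_mul_of_nonneg_left hBi hN
  have h7 : deviation P S (bracket P V k r) =
    ∑ j, bracket P V k r (S j) - N * ∫ ω, bracket P V k r ω ∂P := rfl
  linarith

theorem measureReal_chainLink_bad_le (N : ℕ) (hVm : ∀ i, Measurable (V i))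
    (hM : ∀ i ω, V i ω ≤ M) (hV : ∀ ω, Monotone fun i => V i ω)
    (hh : ∀ i, Measurable (h i)) (h0 : ∀ i ω, 0 ≤ h i ω) (h1 : ∀ i ω, h i ω ≤ 1)
    (hVh : ∀ i j ω, V i ω = V j ω → h i ω = h j ω) (hM1 : 1 ≤ M) (k : ℕ) {s : ℝ} (hs : 0 ≤ s)
    (hs' : s ≤ 4 * (1 / 2) ^ k) :
    (Measure.pi fun _ : Fin N => P).real
      {S | ∃ i, N * s ≤ |deviation P S (chainLink P V h k (levelRep P V k i))|} ≤
      4 * M * 2 ^ k * Real.exp (-(N * s ^ 2 / (8 * (1 / 2) ^ k))) := by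
  classical
  have hset : {S : Fin N → Ω | ∃ i,
        N * s ≤ |deviation P S (chainLink P V h k (levelRep P V k i))|} ⊆
      ⋃ r ∈ univ.image (levelRep P V k), {S | N * s ≤ |deviation P S (chainLink P V h k r)|} := by
    rintro S ⟨i, hi⟩
    simp only [Set.mem_iUnion]
    exact ⟨_, mem_image_of_mem _ (mem_univ i), hi⟩
  refine (measureReal_mono hset (measure_ne_top (Measure.pi fun _ : Fin N => P) _)).trans
    ((measureReal_biUnion_finset_le _ _).trans ?_)
  refine (sum_le_card_nsmul _ _ (2 * Real.exp (-(N * s ^ 2 / (8 * (1 / 2) ^ k))))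
    fun r _ => ?_).trans ?_
  · have := measureReal_le_abs_deviation_le P N (measurable_chainLink (P := P) (V := V) hh k r)
      (abs_chainLink_le h0 h1 k r) (v := 2 * (1 / 2) ^ k) (by positivity)
      (integral_chainLink_sq_le hVm hM hV h0 h1 hVh k r) hs (by linarith)
    rwa [← mul_assoc, show (4 : ℝ) * 2 = 8 by norm_num] at this
  · have hc := card_image_bucketMin_le (meanBucket P V k) (meanBucket_le P hVm hM k)
    have hc' : ((univ.image (levelRep P V k)).card : ℝ) ≤ 2 * M * 2 ^ k := by
      have : (univ.image (levelRep P V k)).card ≤ 2 * M * 2 ^ k := by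
        have : 1 ≤ M * 2 ^ k := Nat.one_le_iff_ne_zero.2 (by positivity)
        change _ ≤ _ at hc
        refine hc.trans ?_
        linarith
      exact_mod_cast this
    rw [nsmul_eq_mul]
    calc _ ≤ 2 * M * 2 ^ k * (2 * Real.exp (-(N * s ^ 2 / (8 * (1 / 2) ^ k)))) := by gcongr
      _ = _ := by ring

theorem measureReal_bracket_bad_le (N : ℕ) (hVm : ∀ i, Measurable (V i))
    (hM : ∀ i ω, V i ω ≤ M) (hV : ∀ ω, Monotone fun i => V i ω) (hM1 : 1 ≤ M) (k : ℕ) :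
    (Measure.pi fun _ : Fin N => P).real
      {S | ∃ i, N * (1 / 2) ^ k ≤ deviation P S (bracket P V k (levelRep P V k i))} ≤
      4 * M * 2 ^ k * Real.exp (-(N * (1 / 2) ^ k / 4)) := by
  classical
  have hset : {S : Fin N → Ω | ∃ i,
        N * (1 / 2) ^ k ≤ deviation P S (bracket P V k (levelRep P V k i))} ⊆
      ⋃ r ∈ univ.image (levelRep P V k), {S | N * (1 / 2) ^ k ≤ deviation P S (bracket P V k r)} := by
    rintro S ⟨i, hi⟩
    simp only [Set.mem_iUnion]
    exact ⟨_, mem_image_of_mem _ (mem_univ i), hi⟩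
  refine (measureReal_mono hset (measure_ne_top (Measure.pi fun _ : Fin N => P) _)).trans
    ((measureReal_biUnion_finset_le _ _).trans ?_)
  refine (sum_le_card_nsmul _ _ (Real.exp (-(N * (1 / 2) ^ k / 4))) fun r hr => ?_).trans ?_
  · have hp : (0 : ℝ) < (1 / 2) ^ k := by positivity
    have hsq : ∀ ω, bracket P V k r ω ^ 2 = bracket P V k r ω := by
      intro ω; unfold bracket; split_ifs <;> norm_num
    have := measureReal_le_deviation_le P N (measurable_bracket (P := P) hVm k r)
      (fun ω => by unfold bracket; split_ifs <;> norm_num) hp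
      (by simp only [hsq]
          exact integral_indicator_ne_le P hVm hM hV k (le_bucketMax _ rfl)
            (apply_bucketMax _ _).symm) hp.le (by linarith)
    refine this.trans (Real.exp_le_exp.2 (le_of_eq ?_))
    field_simp
  · have hc := card_image_bucketMin_le (meanBucket P V k) (meanBucket_le P hVm hM k)
    have hc' : ((univ.image (levelRep P V k)).card : ℝ) ≤ 4 * M * 2 ^ k := by
      have : (univ.image (levelRep P V k)).card ≤ 4 * M * 2 ^ k := by
        have : 1 ≤ M * 2 ^ k := Nat.one_le_iff_ne_zero.2 (by positivity)
        refine hc.trans ?_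
        linarith
      exact_mod_cast this
    rw [nsmul_eq_mul]
    gcongr

/-- The bound depends on `M` but not on the size of `ι`, and chaining avoids a factor `log (1 / ε)`.
-/
theorem measureReal_exists_deviation_gt_le (N : ℕ) (hVm : ∀ i, Measurable (V i))
    (hM : ∀ i ω, V i ω ≤ M) (hV : ∀ ω, Monotone fun i => V i ω)
    (hh : ∀ i, Measurable (h i)) (h0 : ∀ i ω, 0 ≤ h i ω) (h1 : ∀ i ω, h i ω ≤ 1)
    (hVh : ∀ i j ω, V i ω = V j ω → h i ω = h j ω) (hM1 : 1 ≤ M) {ε δ Λ : ℝ} (hε : 0 < ε)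
    (hε1 : ε ≤ 1) (hδ : 0 ≤ δ) (hΛ : 0 ≤ Λ) (hΛ1 : Real.exp (-Λ) ≤ δ / M)
    (hΛ2 : Real.exp (-Λ) ≤ 1 / 2) (hN : 32768 * Λ ≤ N * ε ^ 2) :
    (Measure.pi fun _ : Fin N => P).real {S | ∃ i, N * ε < |deviation P S (h i)|} ≤ δ := by
  have hN0 : (0 : ℝ) ≤ N := Nat.cast_nonneg N
  have hM0 : (0 : ℝ) < M := by exact_mod_cast hM1
  -- The finest level satisfies `8 / ε < 2 ^ K ≤ 16 / ε`. The lower bound makes the remainder small,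
  -- the upper one keeps `s k` within the Bernstein range.
  obtain ⟨K', hK1, hK2⟩ := exists_nat_pow_near (x := 8 / ε) (y := (2 : ℝ))
    ((one_le_div hε).2 (by linarith)) (by norm_num)
  set K := K' + 1 with hK
  have hKu : (2 : ℝ) ^ K ≤ 16 / ε := by
    rw [hK, pow_succ]
    calc (2 : ℝ) ^ K' * 2 ≤ 8 / ε * 2 := by gcongr
      _ = 16 / ε := by ring
  have hhalf : ∀ k : ℕ, (1 / 2 : ℝ) ^ k = 1 / 2 ^ k := fun k => one_div_pow _ _
  have hKl : (1 / 2 : ℝ) ^ K ≤ ε / 8 := by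
    rw [hhalf, div_le_div_iff₀ (by positivity) (by norm_num)]
    rw [div_lt_iff₀ hε] at hK2
    linarith
  -- The ratio `3 / 4` lies between `1 / √2` and `1`: the thresholds sum to at most `ε / 4`, while
  -- the exponent `N * s k ^ 2 / (8 * 2⁻ᵏ)` still grows like `(9 / 8) ^ k`.
  set s : ℕ → ℝ := fun k => ε / 16 * (3 / 4) ^ k with hs
  have hs0 : ∀ k, 0 ≤ s k := fun k => by positivity
  have hs4 : ∀ k ≤ K, s k ≤ 4 * (1 / 2) ^ k := by
    intro k hk
    have e1 : (3 / 4 : ℝ) ^ k = (3 / 2) ^ k * (1 / 2) ^ k := by rw [← mul_pow]; norm_num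
    have e2 : (3 / 2 : ℝ) ^ k ≤ 16 / ε :=
      ((pow_le_pow_left₀ (by norm_num) (by norm_num) k).trans
        (pow_le_pow_right₀ (by norm_num : (1 : ℝ) ≤ 2) hk)).trans hKu
    calc s k = ε / 16 * (3 / 2) ^ k * (1 / 2) ^ k := by simp only [hs]; rw [e1]; ring
      _ ≤ ε / 16 * (16 / ε) * (1 / 2) ^ k := by gcongr
      _ = 1 * (1 / 2) ^ k := by congr 1; field_simp
      _ ≤ _ := by gcongr; norm_num
  have hsum : ∑ j ∈ range (K + 1), s j ≤ ε / 4 := by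
    simp only [hs]
    rw [← mul_sum, geom_sum_eq (by norm_num)]
    have : (0 : ℝ) ≤ (3 / 4) ^ (K + 1) := by positivity
    have e : ((3 / 4 : ℝ) ^ (K + 1) - 1) / (3 / 4 - 1) ≤ 4 := by
      rw [div_le_iff_of_neg (by norm_num)]; linarith
    nlinarith
  let bad : ℕ → Set (Fin N → Ω) := fun k =>
    {S | ∃ i, N * s k ≤ |deviation P S (chainLink P V h k (levelRep P V k i))|}
  let badB : Set (Fin N → Ω) :=
    {S | ∃ i, N * (1 / 2) ^ K ≤ deviation P S (bracket P V K (levelRep P V K i))}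
  have hbad : ∀ k ∈ range (K + 1), (Measure.pi fun _ : Fin N => P).real (bad k) ≤
      δ * (1 / 4) * (1 / 2) ^ k := by
    intro k hk
    refine (measureReal_chainLink_bad_le N hVm hM hV hh h0 h1 hVh hM1 k (hs0 k)
      (hs4 k (by simpa [Nat.lt_succ_iff] using hk))).trans
      (level_tail_le hM0 hδ hΛ hΛ1 hΛ2 ?_)
    have e : N * s k ^ 2 / (8 * (1 / 2) ^ k) = N * ε ^ 2 / 2048 * (9 / 8) ^ k := by
      have : (9 / 8 : ℝ) ^ k = (3 / 4) ^ k * (3 / 4) ^ k * 2 ^ k := by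
        rw [← mul_pow, ← mul_pow]; norm_num
      rw [this, hhalf]
      simp only [hs]
      field_simp
      ring
    rw [e]
    gcongr
    linarith
  have hbadB : (Measure.pi fun _ : Fin N => P).real badB ≤ δ * (1 / 4) * (1 / 2) ^ K := by
    refine (measureReal_bracket_bad_le N hVm hM hV hM1 K).trans
      (level_tail_le hM0 hδ hΛ hΛ1 hΛ2 ?_)
    have e1 : (9 / 8 : ℝ) ^ K ≤ 16 / ε :=
      (pow_le_pow_left₀ (by norm_num) (by norm_num) K).trans hKu
    have e2 : ε / 16 ≤ (1 / 2 : ℝ) ^ K := by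
      rw [hhalf, div_le_div_iff₀ (by norm_num) (by positivity)]
      rw [le_div_iff₀ hε] at hKu
      linarith
    calc 16 * Λ * (9 / 8) ^ K ≤ 16 * Λ * (16 / ε) := by gcongr
      _ = 256 * Λ / ε := by ring
      _ ≤ N * (ε / 16) / 4 := by
        rw [div_le_iff₀ hε]
        have : N * (ε / 16) / 4 * ε = N * ε ^ 2 / 64 := by ring
        rw [this]
        linarith
      _ ≤ _ := by gcongr
  have hsub : {S : Fin N → Ω | ∃ i, N * ε < |deviation P S (h i)|} ⊆
      (⋃ k ∈ range (K + 1), bad k) ∪ badB := by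
    rintro S ⟨i, hi⟩
    by_contra hcon
    simp only [Set.mem_union, Set.mem_iUnion, not_or, not_exists] at hcon
    have hint : ∀ i, Integrable (h i) P := fun i =>
      .of_bound (hh i).aestronglyMeasurable 1 (.of_forall fun ω => by
        rw [Real.norm_eq_abs, abs_of_nonneg (h0 i ω)]; exact h1 i ω)
    have hg : ∀ k ≤ K, ∀ i,
        |deviation P S (chainLink P V h k (levelRep P V k i))| ≤ N * s k := by
      intro k hk i
      by_contra hlt
      exact hcon.1 k (by simpa [Nat.lt_succ_iff] using hk) ⟨i, (not_le.1 hlt).le⟩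
    have hg' : deviation P S (bracket P V K (levelRep P V K i)) ≤ N * (1 / 2) ^ K := by
      by_contra hlt
      exact hcon.2 ⟨i, (not_le.1 hlt).le⟩
    have a1 := abs_deviation_levelRep_le S hint hg K le_rfl i
    have a2 := abs_deviation_le_bracket (P := P) S hVm hM hV hh h0 h1 hVh K i
    have a3 := mul_le_mul_of_nonneg_left hsum hN0
    have a4 := mul_le_mul_of_nonneg_left hKl hN0
    -- The total deviation is at most `N * (ε / 4 + 3 * (ε / 8))`, which is at most `N * ε`.
    nlinarith [mul_nonneg hN0 hε.le]
  have hfin : ∑ k ∈ range (K + 1), δ * (1 / 4) * (1 / 2) ^ k ≤ δ / 2 := by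
    rw [← mul_sum, geom_sum_eq (by norm_num)]
    have : (0 : ℝ) ≤ (1 / 2) ^ (K + 1) := by positivity
    have e : ((1 / 2 : ℝ) ^ (K + 1) - 1) / (1 / 2 - 1) ≤ 2 := by
      rw [div_le_iff_of_neg (by norm_num)]; linarith
    nlinarith
  have hK1' : (1 / 2 : ℝ) ^ K ≤ 1 := pow_le_one₀ (by norm_num) (by norm_num)
  have f1 := measureReal_mono hsub (measure_ne_top (Measure.pi fun _ : Fin N => P) _)
  have f2 := measureReal_union_le (μ := Measure.pi fun _ : Fin N => P)
    (⋃ k ∈ range (K + 1), bad k) badB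
  have f3 := (measureReal_biUnion_finset_le (μ := Measure.pi fun _ : Fin N => P)
    (range (K + 1)) bad).trans (sum_le_sum hbad)
  nlinarith

end Chaining

/-! ### Sign changes and positions relative to a finite set of breakpoints. -/

theorem nonpos_iff_of_ne_zero_on_Icc {f : ℝ → ℝ} {a b : ℝ} (hab : a ≤ b)
    (hf : ContinuousOn f (Set.Icc a b)) (h0 : ∀ x ∈ Set.Icc a b, f x ≠ 0) :
    f a ≤ 0 ↔ f b ≤ 0 := by
  constructor <;> intro h <;> by_contra hcon <;> rw [not_le] at hcon
  · obtain ⟨x, hx, hx0⟩ := intermediate_value_Icc hab hf ⟨h, hcon.le⟩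
    exact h0 x hx hx0
  · obtain ⟨x, hx, hx0⟩ := intermediate_value_Icc' hab hf ⟨h, hcon.le⟩
    exact h0 x hx hx0

/-- The position of `x` relative to the points of `s`. -/
noncomputable def relativeRank (s : Finset ℝ) (x : ℝ) : ℕ :=
  (s.filter (· < x)).card + (s.filter (· ≤ x)).card

theorem relativeRank_mono (s : Finset ℝ) : Monotone (relativeRank s) := by
  intro x y hxy
  refine add_le_add (card_le_card fun b => ?_) (card_le_card fun b => ?_) <;>
  · simp only [mem_filter]
    exact fun h => ⟨h.1, by linarith [h.2]⟩

theorem relativeRank_le (s : Finset ℝ) (x : ℝ) : relativeRank s x ≤ 2 * s.card := by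
  have h1 := card_filter_le s (· < x)
  have h2 := card_filter_le s (· ≤ x)
  unfold relativeRank
  omega

/-- Counting both `<` and `≤` gives each breakpoint a rank of its own. This matters because ties
occur at the breakpoint itself, where the learner may behave differently from either side. -/
theorem notMem_of_relativeRank_eq {s : Finset ℝ} {x y : ℝ} (hxy : x < y)
    (h : relativeRank s x = relativeRank s y) : ∀ b ∈ Set.Icc x y, b ∉ s := by
  intro b hb hbs
  have s1 : s.filter (· < x) ⊆ s.filter (· < y) := fun b => by
    simp only [mem_filter]
    exact fun h => ⟨h.1, h.2.trans hxy⟩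
  have s2 : s.filter (· ≤ x) ⊆ s.filter (· ≤ y) := fun b => by
    simp only [mem_filter]
    exact fun h => ⟨h.1, h.2.trans hxy.le⟩
  have c1 := card_le_card s1
  have c2 := card_le_card s2
  unfold relativeRank at h
  have e1 := eq_of_subset_of_card_le s1 (by omega)
  have e2 := eq_of_subset_of_card_le s2 (by omega)
  rcases hb.2.lt_or_eq with hlt | rfl
  · have : b ∈ s.filter (· < x) := by rw [e1]; exact mem_filter.2 ⟨hbs, hlt⟩
    exact absurd (mem_filter.1 this).2 (not_lt.2 hb.1)
  · have : b ∈ s.filter (· ≤ x) := by rw [e2]; exact mem_filter.2 ⟨hbs, le_rfl⟩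
    exact absurd (mem_filter.1 this).2 (not_le.2 hxy)

/-! ### The learner sees a dataset only through the values of `F` and the labels. -/

namespace TopDown
namespace DTree
variable {𝒳 : Type u} {c : ℕ}

/-- All internal nodes are labeled by functions in `F`. -/
def NodesIn (F : Finset (𝒳 → Bool)) : DTree 𝒳 c → Prop
  | leaf _ => True
  | node f l r => f ∈ F ∧ l.NodesIn F ∧ r.NodesIn F

variable {F : Finset (𝒳 → Bool)}

theorem leafOf_congr {T : DTree 𝒳 c} (hT : T.NodesIn F) {x x' : 𝒳} (h : ∀ f ∈ F, f x = f x') :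
    T.leafOf x = T.leafOf x' := by
  induction T with
  | leaf y => rfl
  | node f l r ihl ihr => simp only [leafOf, h f hT.1, ihl hT.2.1, ihr hT.2.2]

theorem predict_congr {T : DTree 𝒳 c} (hT : T.NodesIn F) {x x' : 𝒳} (h : ∀ f ∈ F, f x = f x') :
    T.predict x = T.predict x' := by
  induction T with
  | leaf y => rfl
  | node f l r ihl ihr => simp only [predict, h f hT.1, ihl hT.2.1, ihr hT.2.2]

theorem NodesIn.replaceLeaf {T : DTree 𝒳 c} (hT : T.NodesIn F) {f : 𝒳 → Bool} (hf : f ∈ F)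
    (a : List Bool) (y₀ y₁ : Fin c) : (T.replaceLeaf a f y₀ y₁).NodesIn F := by
  induction T generalizing a with
  | leaf y =>
    rcases a with _ | ⟨_ | _, a⟩
    · exact ⟨hf, trivial, trivial⟩
    · exact hT
    · exact hT
  | node g l r ihl ihr =>
    rcases a with _ | ⟨_ | _, a⟩
    · exact hT
    · exact ⟨hT.1, ihl hT.2.1 a, hT.2.2⟩
    · exact ⟨hT.1, hT.2.1, ihr hT.2.2 a⟩

theorem card_leaves_replaceLeaf_le (T : DTree 𝒳 c) {a : List Bool} (f : 𝒳 → Bool) (y₀ y₁ : Fin c)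
    (ha : a ∈ T.leaves) : (T.replaceLeaf a f y₀ y₁).leaves.card ≤ T.leaves.card + 1 := by
  rw [leaves_replaceLeaf _ _ _ _ _ ha]
  have h1 := card_union_le (T.leaves.erase a) {a ++ [false], a ++ [true]}
  have h2 : ({a ++ [false], a ++ [true]} : Finset (List Bool)).card ≤ 2 := card_le_two
  have h3 := card_erase_add_one ha
  omega

end DTree

noncomputable section
variable {𝒳 : Type u} {c n : ℕ} {F : Finset (𝒳 → Bool)} {D D' : Dataset 𝒳 c n}

/-- The values of the functions in `F` on the examples of a dataset, with the labels. -/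
def trace (F : Finset (𝒳 → Bool)) (D : Dataset 𝒳 c n) : Fin n → (F → Bool) × Fin c :=
  fun i => (fun f => f.1 (D i).1, (D i).2)

theorem apply_eq_of_trace_eq (h : trace F D = trace F D') (i : Fin n) {f : 𝒳 → Bool}
    (hf : f ∈ F) : f (D i).1 = f (D' i).1 :=
  congrFun (congrArg Prod.fst (congrFun h i)) ⟨f, hf⟩

theorem label_eq_of_trace_eq (h : trace F D = trace F D') (i : Fin n) : (D i).2 = (D' i).2 :=
  show (trace F D i).2 = (trace F D' i).2 from congrArg Prod.snd (congrFun h i)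

theorem points_congr (h : trace F D = trace F D') {T : DTree 𝒳 c} (hT : T.NodesIn F)
    (a : List Bool) : points D T a = points D' T a := by
  unfold points
  refine filter_congr fun i _ => ?_
  rw [DTree.leafOf_congr hT fun f hf => apply_eq_of_trace_eq h i hf]

theorem labelCount_congr (h : trace F D = trace F D') (s : Finset (Fin n)) (k : Fin c) :
    labelCount D s k = labelCount D' s k := by
  unfold labelCount
  congr 1
  exact filter_congr fun i _ => by rw [label_eq_of_trace_eq h i]

theorem majority_congr (B : TieBreak 𝒳 c) (h : trace F D = trace F D') (s : Finset (Fin n)) :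
    majority B D s = majority B D' s := by
  simp only [majority, mostFrequent, labelCount_congr h]

theorem split_congr (B : TieBreak 𝒳 c) (h : trace F D = trace F D') {T : DTree 𝒳 c}
    (hT : T.NodesIn F) (a : List Bool) {f : 𝒳 → Bool} (hf : f ∈ F) :
    split B D T a f = split B D' T a f := by
  simp only [split, majority_congr B h, points_congr h hT, apply_eq_of_trace_eq h _ hf]

theorem splitFun_congr (C γ : ℝ) (h : trace F D = trace F D') {T : DTree 𝒳 c}
    (hT : T.NodesIn F) : splitFun C γ D T = splitFun C γ D' T := by
  simp only [splitFun_eq_sum_groupTerm, groupTerm, points_congr h hT, labelCount_congr h]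

theorem NodesIn_split (B : TieBreak 𝒳 c) (D : Dataset 𝒳 c n) {T : DTree 𝒳 c} (hT : T.NodesIn F)
    (a : List Bool) {f : 𝒳 → Bool} (hf : f ∈ F) : (split B D T a f).NodesIn F :=
  hT.replaceLeaf hf a _ _

theorem bestSplits_congr (B : TieBreak 𝒳 c) (C γ : ℝ) (h : trace F D = trace F D')
    {T : DTree 𝒳 c} (hT : T.NodesIn F) : bestSplits B F C γ D T = bestSplits B F C γ D' T := by
  have key : ∀ q ∈ candidates F T, splitFun C γ D (split B D T q.1 q.2) =
      splitFun C γ D' (split B D' T q.1 q.2) := by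
    intro q hq
    have hq2 : q.2 ∈ F := (mem_product.1 hq).2
    rw [split_congr B h hT q.1 hq2, splitFun_congr C γ h (NodesIn_split B D' hT q.1 hq2)]
  unfold bestSplits
  refine filter_congr fun q hq => forall₂_congr fun q' hq' => ?_
  rw [key q hq, key q' hq']

theorem bestSplits_nonempty (B : TieBreak 𝒳 c) (hF : F.Nonempty) (C γ : ℝ) (D : Dataset 𝒳 c n)
    (T : DTree 𝒳 c) : (bestSplits B F C γ D T).Nonempty := by
  obtain ⟨q, hq, hmin⟩ := exists_min_image (candidates F T)
    (fun q => splitFun C γ D (split B D T q.1 q.2)) (T.leaves_nonempty.product hF)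
  exact ⟨q, mem_filter.2 ⟨hq, hmin⟩⟩

theorem pickSplit_mem_candidates (B : TieBreak 𝒳 c) (hF : F.Nonempty) (C γ : ℝ)
    (D : Dataset 𝒳 c n) (T : DTree 𝒳 c) :
    B.pickSplit T (bestSplits B F C γ D T) ∈ candidates F T :=
  filter_subset _ _ (B.pickSplit_mem T _ (bestSplits_nonempty B hF C γ D T))

theorem NodesIn_growStep (B : TieBreak 𝒳 c) (hF : F.Nonempty) (C γ : ℝ) (D : Dataset 𝒳 c n)
    {T : DTree 𝒳 c} (hT : T.NodesIn F) : (growStep B F C γ D T).NodesIn F :=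
  NodesIn_split B D hT _ (mem_product.1 (pickSplit_mem_candidates B hF C γ D T)).2

theorem growStep_congr (B : TieBreak 𝒳 c) (hF : F.Nonempty) (C γ : ℝ)
    (h : trace F D = trace F D') {T : DTree 𝒳 c} (hT : T.NodesIn F) :
    growStep B F C γ D T = growStep B F C γ D' T := by
  unfold growStep
  rw [bestSplits_congr B C γ h hT]
  exact split_congr B h hT _ (mem_product.1 (pickSplit_mem_candidates B hF C γ D' T)).2

theorem learn_zero (B : TieBreak 𝒳 c) (F : Finset (𝒳 → Bool)) (C γ : ℝ) (D : Dataset 𝒳 c n) :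
    learn B F C γ 0 D = DTree.leaf (majority B D univ) := rfl

theorem learn_succ (B : TieBreak 𝒳 c) (F : Finset (𝒳 → Bool)) (C γ : ℝ) (t : ℕ)
    (D : Dataset 𝒳 c n) :
    learn B F C γ (t + 1) D = growStep B F C γ D (learn B F C γ t D) :=
  Function.iterate_succ_apply' _ _ _

theorem NodesIn_learn (B : TieBreak 𝒳 c) (hF : F.Nonempty) (C γ : ℝ) (t : ℕ)
    (D : Dataset 𝒳 c n) : (learn B F C γ t D).NodesIn F := by
  induction t with
  | zero => trivial
  | succ t ih =>
    rw [learn_succ]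
    exact NodesIn_growStep B hF C γ D ih

theorem learn_congr (B : TieBreak 𝒳 c) (hF : F.Nonempty) (C γ : ℝ) (t : ℕ)
    (h : trace F D = trace F D') : learn B F C γ t D = learn B F C γ t D' := by
  induction t with
  | zero => rw [learn_zero, learn_zero, majority_congr B h]
  | succ t ih =>
    rw [learn_succ, learn_succ, growStep_congr B hF C γ h (NodesIn_learn B hF C γ t D), ih]

/-- This serves measurability: the loss factors through `trace F`, which takes values in a finite
discrete type. -/
theorem paramLoss_congr (B : TieBreak 𝒳 c) (hF : F.Nonempty) (C γ : ℝ) (t : ℕ)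
    (h : trace F D = trace F D') : paramLoss B F C t γ D = paramLoss B F C t γ D' := by
  unfold paramLoss zeroOneLoss
  rw [learn_congr B hF C γ t h]
  congr 1
  refine sum_congr rfl fun i _ => ?_
  rw [label_eq_of_trace_eq h i, DTree.predict_congr (NodesIn_learn B hF C γ t D')
    fun f hf => apply_eq_of_trace_eq h i hf]

theorem zeroOneLoss_nonneg (T : DTree 𝒳 c) (D : Dataset 𝒳 c n) : 0 ≤ zeroOneLoss T D :=
  mul_nonneg (by positivity) (sum_nonneg fun i _ => by split_ifs <;> norm_num)

theorem zeroOneLoss_le_one (T : DTree 𝒳 c) (D : Dataset 𝒳 c n) : zeroOneLoss T D ≤ 1 := by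
  unfold zeroOneLoss
  have h : ∑ i, (if T.predict (D i).1 ≠ (D i).2 then (1 : ℝ) else 0) ≤ n := by
    refine (sum_le_card_nsmul univ _ 1 fun i _ => by split_ifs <;> norm_num).trans ?_
    simp
  rw [one_div_mul_eq_div]
  exact div_le_one_of_le₀ h (Nat.cast_nonneg n)

/-! ### Reachable trees and the parameters where the learner may change its choice. -/

open Classical in
/-- The trees that can be obtained from the initial leaf by `i` splits. -/
def reachable (B : TieBreak 𝒳 c) (F : Finset (𝒳 → Bool)) (D : Dataset 𝒳 c n) :
    ℕ → Finset (DTree 𝒳 c)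
  | 0 => {DTree.leaf (majority B D univ)}
  | i + 1 => (reachable B F D i).biUnion fun T =>
      (candidates F T).image fun q => split B D T q.1 q.2

theorem learn_mem_reachable (B : TieBreak 𝒳 c) (hF : F.Nonempty) (C γ : ℝ) (D : Dataset 𝒳 c n)
    (i : ℕ) : learn B F C γ i D ∈ reachable B F D i := by
  classical
  induction i with
  | zero => simp [learn_zero, reachable]
  | succ i ih =>
    rw [learn_succ, reachable, mem_biUnion]
    exact ⟨_, ih, mem_image_of_mem (fun q : List Bool × (𝒳 → Bool) => split B D _ q.1 q.2)
      (pickSplit_mem_candidates B hF C γ D _)⟩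

theorem card_leaves_le_of_mem_reachable (B : TieBreak 𝒳 c) (D : Dataset 𝒳 c n) (i : ℕ) :
    ∀ T ∈ reachable B F D i, T.leaves.card ≤ i + 1 := by
  classical
  induction i with
  | zero => simp [reachable, DTree.leaves]
  | succ i ih =>
    intro T hT
    rw [reachable, mem_biUnion] at hT
    obtain ⟨T', hT', h⟩ := hT
    obtain ⟨q, hq, rfl⟩ := mem_image.1 h
    have := ih T' hT'
    have := T'.card_leaves_replaceLeaf_le q.2
      (majority B D ((points D T' q.1).filter fun i => q.2 (D i).1 = false))
      (majority B D ((points D T' q.1).filter fun i => q.2 (D i).1 = true)) (mem_product.1 hq).1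
    unfold split
    omega

theorem card_candidates_le (B : TieBreak 𝒳 c) (D : Dataset 𝒳 c n) {i t : ℕ} (hi : i < t)
    {T : DTree 𝒳 c} (hT : T ∈ reachable B F D i) : (candidates F T).card ≤ t * F.card := by
  rw [candidates, card_product]
  exact Nat.mul_le_mul_right _ ((card_leaves_le_of_mem_reachable B D i T hT).trans hi)

theorem card_reachable_le (B : TieBreak 𝒳 c) (D : Dataset 𝒳 c n) {i t : ℕ} (hi : i ≤ t) :
    (reachable B F D i).card ≤ (t * F.card) ^ i := by
  classical
  induction i with
  | zero => simp [reachable]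
  | succ i ih =>
    rw [reachable, pow_succ]
    refine card_biUnion_le.trans ((sum_le_card_nsmul _ _ (t * F.card) fun T hT => ?_).trans ?_)
    · exact card_image_le.trans (card_candidates_le B D hi hT)
    · rw [smul_eq_mul]
      exact Nat.mul_le_mul_right _ (ih (by omega))

open Classical in
/-- The parameters at which two splits of `T` are equally good, unless there are more than five. -/
def pairBreaks (B : TieBreak 𝒳 c) (C : ℝ) (D : Dataset 𝒳 c n) (T : DTree 𝒳 c)
    (q q' : List Bool × (𝒳 → Bool)) : Finset ℝ :=
  if h : {γ ∈ Set.Ioc (0 : ℝ) 1 | splitFun C γ D (split B D T q.1 q.2) =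
      splitFun C γ D (split B D T q'.1 q'.2)}.encard ≤ 5 then
    (Set.finite_of_encard_le_coe (k := 5) h).toFinset
  else ∅

theorem card_pairBreaks_le (B : TieBreak 𝒳 c) (C : ℝ) (D : Dataset 𝒳 c n) (T : DTree 𝒳 c)
    (q q' : List Bool × (𝒳 → Bool)) : (pairBreaks B C D T q q').card ≤ 5 := by
  unfold pairBreaks
  split_ifs with h
  · rw [(Set.finite_of_encard_le_coe (k := 5) h).encard_eq_coe_toFinset_card] at h
    exact_mod_cast h
  · simp

/-- Either the two sides agree for all parameters, or `pairBreaks` contains every zero of their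
difference, which is continuous and so keeps its sign. The value `∅` in `pairBreaks` is therefore
harmless. -/
theorem splitFun_le_iff (B : TieBreak 𝒳 c) (C : ℝ) (D : Dataset 𝒳 c n) {T : DTree 𝒳 c}
    {q q' : List Bool × (𝒳 → Bool)} (hq : q.1 ∈ T.leaves) (hq' : q'.1 ∈ T.leaves) {γ γ' : ℝ}
    (h0 : 0 < γ) (hγ : γ ≤ γ') (h1 : γ' ≤ 1)
    (hb : ∀ b ∈ Set.Icc γ γ', b ∉ pairBreaks B C D T q q') :
    splitFun C γ D (split B D T q.1 q.2) ≤ splitFun C γ D (split B D T q'.1 q'.2) ↔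
    splitFun C γ' D (split B D T q.1 q.2) ≤ splitFun C γ' D (split B D T q'.1 q'.2) := by
  rcases encard_eq_splitFun_le B C D T q.1 q'.1 q.2 q'.2 hq hq' with h | h
  · rw [h γ ⟨h0, hγ.trans h1⟩, h γ' ⟨h0.trans_le hγ, h1⟩]
    simp
  · have hc : ∀ T : DTree 𝒳 c, ContinuousOn (fun γ => splitFun C γ D T) (Set.Icc γ γ') := by
      intro T
      simp only [splitFun_eq_sum_groupTerm]
      exact continuousOn_finsetSum _ fun a _ => (continuousOn_groupTerm C D _).mono
        fun x hx => h0.trans_le hx.1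
    have := nonpos_iff_of_ne_zero_on_Icc hγ ((hc (split B D T q.1 q.2)).sub
      (hc (split B D T q'.1 q'.2))) (fun x hx he => hb x hx ?_)
    · simpa only [Pi.sub_apply, sub_nonpos] using this
    · unfold pairBreaks
      rw [dif_pos h, Set.Finite.mem_toFinset]
      exact ⟨⟨h0.trans_le hx.1, hx.2.trans h1⟩, sub_eq_zero.1 he⟩

open Classical in
/-- The parameters at which some greedy choice among `t` rounds may change. -/
def breaks (B : TieBreak 𝒳 c) (F : Finset (𝒳 → Bool)) (C : ℝ) (t : ℕ) (D : Dataset 𝒳 c n) :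
    Finset ℝ :=
  (range t).biUnion fun i => (reachable B F D i).biUnion fun T =>
    (candidates F T ×ˢ candidates F T).biUnion fun p => pairBreaks B C D T p.1 p.2

/-- With `Q = t * F.card`: at most `t ≤ Q` rounds, `Q ^ t` trees per round, `Q ^ 2` pairs of splits
per tree and five breakpoints per pair. -/
theorem card_breaks_le (B : TieBreak 𝒳 c) (C : ℝ) {t : ℕ} (ht : 1 ≤ t) (hF : F.Nonempty)
    (D : Dataset 𝒳 c n) : (breaks B F C t D).card ≤ 5 * (t * F.card) ^ (t + 3) := by
  classical
  have hQ : 1 ≤ t * F.card := Nat.mul_pos ht hF.card_pos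
  have htQ : t ≤ t * F.card := Nat.le_mul_of_pos_right _ hF.card_pos
  calc (breaks B F C t D).card ≤
      (range t).card * ((t * F.card) ^ t * (t * F.card * (t * F.card) * 5)) := by
        refine card_biUnion_le_card_mul _ _ _ fun i hi => ?_
        have hi' := mem_range.1 hi
        refine (card_biUnion_le_card_mul _ _ (t * F.card * (t * F.card) * 5) fun T hT => ?_).trans
          (Nat.mul_le_mul_right _ ((card_reachable_le B D hi'.le).trans
            (Nat.pow_le_pow_right hQ hi'.le)))
        refine (card_biUnion_le_card_mul _ _ 5 fun p _ => card_pairBreaks_le B C D T p.1 p.2).trans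
          (Nat.mul_le_mul_right _ ?_)
        rw [card_product]
        exact Nat.mul_le_mul (card_candidates_le B D hi' hT) (card_candidates_le B D hi' hT)
    _ ≤ (t * F.card) * ((t * F.card) ^ t * (t * F.card * (t * F.card) * 5)) := by
        rw [card_range]
        exact Nat.mul_le_mul_right _ htQ
    _ = 5 * (t * F.card) ^ (t + 3) := by ring

theorem bestSplits_eq_of_notMem_breaks (B : TieBreak 𝒳 c) (C : ℝ) {t i : ℕ} (hi : i < t)
    (D : Dataset 𝒳 c n) {T : DTree 𝒳 c} (hT : T ∈ reachable B F D i) {γ γ' : ℝ} (h0 : 0 < γ)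
    (hγ : γ ≤ γ') (h1 : γ' ≤ 1) (hb : ∀ b ∈ Set.Icc γ γ', b ∉ breaks B F C t D) :
    bestSplits B F C γ D T = bestSplits B F C γ' D T := by
  classical
  unfold bestSplits
  refine filter_congr fun q hq => forall₂_congr fun q' hq' => ?_
  refine splitFun_le_iff B C D (mem_product.1 hq).1 (mem_product.1 hq').1 h0 hγ h1
    fun b hbI hbm => hb b hbI ?_
  exact mem_biUnion.2 ⟨i, mem_range.2 hi, mem_biUnion.2 ⟨T, hT,
    mem_biUnion.2 ⟨(q, q'), mem_product.2 ⟨hq, hq'⟩, hbm⟩⟩⟩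

theorem learn_eq_of_bestSplits_eq (B : TieBreak 𝒳 c) (hF : F.Nonempty) (C : ℝ) (t : ℕ)
    (D : Dataset 𝒳 c n) {γ γ' : ℝ}
    (h : ∀ i < t, ∀ T ∈ reachable B F D i, bestSplits B F C γ D T = bestSplits B F C γ' D T) :
    learn B F C γ t D = learn B F C γ' t D := by
  have key : ∀ i ≤ t, learn B F C γ i D = learn B F C γ' i D := by
    intro i
    induction i with
    | zero => intro _; rw [learn_zero, learn_zero]
    | succ i ih =>
      intro hi
      rw [learn_succ, learn_succ, ih (by omega), growStep, growStep,
        h i (by omega) _ (learn_mem_reachable B hF C γ' D i)]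
  exact key t le_rfl

theorem paramLoss_eq_of_relativeRank_eq (B : TieBreak 𝒳 c) (hF : F.Nonempty) (C : ℝ) (t : ℕ)
    (D : Dataset 𝒳 c n) {γ γ' : ℝ} (hγ : γ ∈ Set.Ioc (0 : ℝ) 1) (hγ' : γ' ∈ Set.Ioc (0 : ℝ) 1)
    (h : relativeRank (breaks B F C t D) γ = relativeRank (breaks B F C t D) γ') :
    paramLoss B F C t γ D = paramLoss B F C t γ' D := by
  unfold paramLoss
  rcases lt_trichotomy γ γ' with hlt | rfl | hlt
  · rw [learn_eq_of_bestSplits_eq B hF C t D fun i hi T hT => bestSplits_eq_of_notMem_breaks B C hi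
      D hT hγ.1 hlt.le hγ'.2 (notMem_of_relativeRank_eq hlt h)]
  · rfl
  · rw [learn_eq_of_bestSplits_eq B hF C t D fun i hi T hT => (bestSplits_eq_of_notMem_breaks B C
      hi D hT hγ'.1 hlt.le hγ.2 (notMem_of_relativeRank_eq hlt h.symm)).symm]

/-- With a single candidate in each round, `γ` plays no role. This covers the case where `log |F| +
log t` vanishes and cannot absorb constants. -/
theorem paramLoss_eq_of_mul_card_le_one (B : TieBreak 𝒳 c) (hF : F.Nonempty) (C : ℝ) {t : ℕ}
    (ht : t * F.card ≤ 1) (D : Dataset 𝒳 c n) (γ γ' : ℝ) :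
    paramLoss B F C t γ D = paramLoss B F C t γ' D := by
  unfold paramLoss
  have key : ∀ γ, ∀ i < t, ∀ T ∈ reachable B F D i, bestSplits B F C γ D T = candidates F T := by
    intro γ i hi T hT
    refine eq_of_subset_of_card_le (filter_subset _ _) ?_
    exact ((card_candidates_le B D hi hT).trans ht).trans
      (bestSplits_nonempty B hF C γ D T).card_pos
  rw [learn_eq_of_bestSplits_eq B hF C t D fun i hi T hT =>
    (key γ i hi T hT).trans (key γ' i hi T hT).symm]

theorem measurable_trace [MeasurableSpace 𝒳] (hF : ∀ f ∈ F, Measurable f) :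
    Measurable (trace F : Dataset 𝒳 c n → _) := by
  refine measurable_pi_lambda _ fun i => Measurable.prodMk (measurable_pi_lambda _ fun f => ?_) ?_
  · exact (hF f.1 f.2).comp (measurable_fst.comp (measurable_pi_apply i))
  · exact measurable_snd.comp (measurable_pi_apply i)

end
end TopDown

theorem exists_finset_forall_exists_eq {α β : Type*} [Finite β] (g : α → β) :
    ∃ s : Finset α, ∀ a, ∃ a' ∈ s, g a' = g a := by
  classical
  have := Fintype.ofFinite (Set.range g)
  refine ⟨univ.image fun w : Set.range g => w.2.choose, fun a => ⟨_, mem_image_of_mem _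
    (mem_univ ⟨g a, a, rfl⟩), ?_⟩⟩
  exact (⟨g a, a, rfl⟩ : Set.range g).2.choose_spec

/-! ### Uniform convergence of the losses and the sample bound. -/

namespace TopDown
noncomputable section
variable {𝒳 : Type u} [MeasurableSpace 𝒳] {c n : ℕ} {F : Finset (𝒳 → Bool)}

theorem measureReal_exists_deviation_paramLoss_gt_le (B : TieBreak 𝒳 c) (hF : F.Nonempty)
    (hFm : ∀ f ∈ F, Measurable f) (C : ℝ) {t : ℕ} (ht : 1 ≤ t) (N : ℕ)
    (P : Measure (Dataset 𝒳 c n)) [IsProbabilityMeasure P] {ε δ Λ : ℝ} (hε : 0 < ε)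
    (hε1 : ε ≤ 1) (hδ : 0 ≤ δ) (hΛ : 0 ≤ Λ)
    (hΛ1 : Real.exp (-Λ) ≤ δ / ((2 * (5 * (t * F.card) ^ (t + 3)) : ℕ) : ℝ))
    (hΛ2 : Real.exp (-Λ) ≤ 1 / 2) (hN : 32768 * Λ ≤ N * ε ^ 2) :
    (Measure.pi fun _ : Fin N => P).real {S | ∃ γ ∈ Set.Ioc (0 : ℝ) 1,
      N * ε < |deviation P S (paramLoss B F C t γ)|} ≤ δ := by
  have : Nonempty (Dataset 𝒳 c n) := nonempty_of_isProbabilityMeasure P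
  set M := 2 * (5 * (t * F.card) ^ (t + 3)) with hM
  -- Computing breakpoints on a representative of each trace makes the rank a function of the trace,
  -- hence measurable.
  let rep : (Fin n → (F → Bool) × Fin c) → Dataset 𝒳 c n := Function.invFun (trace F)
  have hrep : ∀ D, trace F (rep (trace F D)) = trace F D := fun D => Function.invFun_eq ⟨D, rfl⟩
  have hrank : ∀ z γ, relativeRank (breaks B F C t (rep z)) γ ≤ M := fun z γ =>
    (relativeRank_le _ _).trans (Nat.mul_le_mul_left _ (card_breaks_le B C ht hF _))
  -- Finitely many traces and ranks leave finitely many rank profiles. One parameter per profile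
  -- replaces `(0, 1]` by the finite index set that chaining needs.
  obtain ⟨s, hs⟩ := exists_finset_forall_exists_eq
    (fun (γ : Set.Ioc (0 : ℝ) 1) z => (⟨relativeRank (breaks B F C t (rep z)) γ,
      Nat.lt_succ_of_le (hrank z γ)⟩ : Fin (M + 1)))
  have hloss : ∀ γ D, paramLoss B F C t γ D = paramLoss B F C t γ (rep (trace F D)) := fun γ D =>
    paramLoss_congr B hF C γ t (hrep D).symm
  have hmain := measureReal_exists_deviation_gt_le (P := P) (ι := s) (M := M)
    (V := fun i D => relativeRank (breaks B F C t (rep (trace F D))) i.1.1)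
    (h := fun i => paramLoss B F C t i.1.1) N
    (fun i => (Measurable.of_discrete (f := fun z => relativeRank (breaks B F C t (rep z))
      i.1.1)).comp (measurable_trace hFm))
    (fun i D => hrank _ _)
    (fun D i j hij => relativeRank_mono _ hij)
    (fun i => by
      rw [show paramLoss B F C t i.1.1 = (fun z => paramLoss B F C t i.1.1 (rep z)) ∘ trace F from
        funext (hloss _)]
      exact Measurable.of_discrete.comp (measurable_trace hFm))
    (fun i D => zeroOneLoss_nonneg _ _) (fun i D => zeroOneLoss_le_one _ _)
    (fun i j D hij => by
      rw [hloss, hloss j.1.1]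
      exact paramLoss_eq_of_relativeRank_eq B hF C t _ i.1.2 j.1.2 hij)
    (Nat.mul_pos two_pos (Nat.mul_pos (by norm_num)
      (Nat.pow_pos (Nat.mul_pos ht hF.card_pos)))) hε hε1 hδ hΛ hΛ1 hΛ2 hN
  refine (measureReal_mono ?_ (measure_ne_top (Measure.pi fun _ : Fin N => P) _)).trans hmain
  rintro S ⟨γ, hγ, hdev⟩
  obtain ⟨γ', hγ', he⟩ := hs ⟨γ, hγ⟩
  refine ⟨⟨γ', hγ'⟩, ?_⟩
  have : paramLoss B F C t γ'.1 = (paramLoss B F C t γ : Dataset 𝒳 c n → ℝ) := by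
    funext D
    rw [hloss, hloss γ]
    exact paramLoss_eq_of_relativeRank_eq B hF C t _ γ'.2 hγ
      (congrArg Fin.val (congrFun he (trace F D)))
  simp only [this]
  exact hdev

theorem isEpsOptimal_of_abs_deviation_le (B : TieBreak 𝒳 c) (C : ℝ) (t : ℕ) {N : ℕ} (hN : 0 < N)
    (P : Measure (Dataset 𝒳 c n)) {ε : ℝ} (S : Fin N → Dataset 𝒳 c n)
    (h : ∀ γ ∈ Set.Ioc (0 : ℝ) 1, |deviation P S (paramLoss B F C t γ)| ≤ N * (ε / 2)) {γ : ℝ}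
    (hγ : IsERM B F C t S γ) : IsEpsOptimal B F C t P ε γ := by
  intro γ' hγ'
  have h1 := (abs_le.1 (h γ hγ.1)).1
  have h2 := (abs_le.1 (h γ' hγ')).2
  have h3 := hγ.2 γ' hγ'
  have hN' : (0 : ℝ) < N := by exact_mod_cast hN
  unfold deviation at h1 h2
  unfold expectedLoss
  refine le_of_mul_le_mul_left ?_ hN'
  linarith

theorem expectedLoss_mem_Icc (B : TieBreak 𝒳 c) (C : ℝ) (t : ℕ) (P : Measure (Dataset 𝒳 c n))
    [IsProbabilityMeasure P] (γ : ℝ) : expectedLoss B F C t P γ ∈ Set.Icc (0 : ℝ) 1 := by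
  refine ⟨integral_nonneg fun D => zeroOneLoss_nonneg _ _, ?_⟩
  have : expectedLoss B F C t P γ ≤ ∫ _, (1 : ℝ) ∂P :=
    integral_mono_of_nonneg (.of_forall fun D => zeroOneLoss_nonneg _ _) (integrable_const _)
      (.of_forall fun D => zeroOneLoss_le_one _ _)
  simpa using this

theorem one_sub_le_measureReal_isERM_imp (B : TieBreak 𝒳 c) (hF : F.Nonempty)
    (hFm : ∀ f ∈ F, Measurable f) (C : ℝ) {t : ℕ} (ht : 1 ≤ t) (N : ℕ)
    (P : Measure (Dataset 𝒳 c n)) [IsProbabilityMeasure P] {ε δ : ℝ} (hε : 0 < ε) (hδ : 0 < δ)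
    (hN : 1048576 * (1 / ε ^ 2 * (t * (Real.log F.card + Real.log t) + Real.log (1 / δ))) ≤ N) :
    1 - δ ≤ (Measure.pi fun _ : Fin N => P).real
      {S | ∀ γ, IsERM B F C t S γ → IsEpsOptimal B F C t P ε γ} := by
  have huniv : (∀ γ, IsEpsOptimal B F C t P ε γ) → 1 - δ ≤ (Measure.pi fun _ : Fin N => P).real
      {S | ∀ γ, IsERM B F C t S γ → IsEpsOptimal B F C t P ε γ} := by
    intro h
    rw [show {S : Fin N → Dataset 𝒳 c n | ∀ γ, IsERM B F C t S γ → IsEpsOptimal B F C t P ε γ} =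
      Set.univ from Set.eq_univ_of_forall fun S γ _ => h γ, probReal_univ]
    linarith
  rcases le_or_gt 1 δ with hδ1 | hδ1
  · exact (sub_nonpos.2 hδ1).trans measureReal_nonneg
  rcases le_or_gt 1 ε with hε1 | hε1
  · refine huniv fun γ γ' _ => ?_
    have h1 := expectedLoss_mem_Icc (F := F) B C t P γ
    have h2 := expectedLoss_mem_Icc (F := F) B C t P γ'
    linarith [h1.2, h2.1]
  rcases le_or_gt (t * F.card) 1 with hQ | hQ
  · refine huniv fun γ γ' _ => ?_
    unfold expectedLoss
    simp only [paramLoss_eq_of_mul_card_le_one B hF C hQ _ γ γ']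
    linarith
  have hQ2 : (2 : ℝ) ≤ ((t * F.card : ℕ) : ℝ) := by exact_mod_cast hQ
  have hlog : Real.log F.card + Real.log t = Real.log ((t * F.card : ℕ) : ℝ) := by
    rw [Nat.cast_mul, Real.log_mul (by positivity) (by simpa using hF.ne_empty), add_comm]
  rw [hlog] at hN
  have hlogpos : 0 < Real.log ((t * F.card : ℕ) : ℝ) := Real.log_pos (by linarith)
  have hδlog : 0 < Real.log (1 / δ) := Real.log_pos ((one_lt_div hδ).2 hδ1)
  have ht' : (1 : ℝ) ≤ t := by exact_mod_cast ht
  set Q : ℝ := ((t * F.card : ℕ) : ℝ) with hQdef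
  have hM : ((2 * (5 * (t * F.card) ^ (t + 3)) : ℕ) : ℝ) = 10 * Q ^ (t + 3) := by
    rw [Nat.cast_mul, Nat.cast_mul, Nat.cast_pow, ← hQdef]
    push_cast
    ring
  -- Here `Q ≥ 2` gives `10 ≤ Q ^ 4`, and `t ≥ 1` gives `t + 7 ≤ 8 * t`. So `log M` is at most `8 *
  -- t * log Q`.
  have hMu : 10 * Q ^ (t + 3) ≤ Q ^ (8 * t) := by
    calc 10 * Q ^ (t + 3) ≤ Q ^ 4 * Q ^ (t + 3) := by
          gcongr
          calc (10 : ℝ) ≤ 2 ^ 4 := by norm_num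
            _ ≤ Q ^ 4 := by gcongr
      _ = Q ^ (t + 7) := by ring
      _ ≤ Q ^ (8 * t) := pow_le_pow_right₀ (by linarith) (by omega)
  have hM2 : 2 ≤ 10 * Q ^ (t + 3) := by
    have : 1 ≤ Q ^ (t + 3) := one_le_pow₀ (by linarith)
    linarith
  have hM0 : 0 < 10 * Q ^ (t + 3) := by linarith
  set Λ := Real.log (10 * Q ^ (t + 3)) + Real.log (1 / δ) with hΛdef
  have hexp : Real.exp (-Λ) = δ / (10 * Q ^ (t + 3)) := by
    rw [hΛdef, ← Real.log_mul hM0.ne' (by positivity), Real.exp_neg, Real.exp_log (by positivity)]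
    field_simp
  have hΛ0 : 0 ≤ Λ := add_nonneg (Real.log_nonneg (by linarith)) hδlog.le
  have hΛu : Λ ≤ 8 * (t * Real.log Q + Real.log (1 / δ)) := by
    have := Real.log_le_log hM0 hMu
    rw [Real.log_pow] at this
    push_cast at this
    linarith
  have hpos : 0 < t * Real.log Q + Real.log (1 / δ) := by positivity
  have hN0 : 0 < N := by
    have : (0 : ℝ) < N := lt_of_lt_of_le (by positivity) hN
    exact_mod_cast this
  have hN' : 32768 * Λ ≤ N * (ε / 2) ^ 2 := by
    have h1 : 1048576 * (t * Real.log Q + Real.log (1 / δ)) ≤ N * ε ^ 2 := by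
      rw [one_div_mul_eq_div, ← mul_div_assoc, div_le_iff₀ (by positivity)] at hN
      exact hN
    have h2 : N * (ε / 2) ^ 2 = N * ε ^ 2 / 4 := by ring
    rw [h2]
    linarith
  have hbad := measureReal_exists_deviation_paramLoss_gt_le B hF hFm C ht N P (half_pos hε)
    (by linarith) hδ.le hΛ0 (by rw [hM, hexp])
    (by
      rw [hexp, div_le_div_iff₀ hM0 two_pos]
      linarith) hN'
  -- Covering the whole space and using subadditivity avoids proving that the events are measurable.
  have hcover := measureReal_mono (μ := Measure.pi fun _ : Fin N => P) (s₁ := Set.univ)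
    (s₂ := {S | ∀ γ, IsERM B F C t S γ → IsEpsOptimal B F C t P ε γ} ∪
      {S | ∃ γ ∈ Set.Ioc (0 : ℝ) 1, N * (ε / 2) < |deviation P S (paramLoss B F C t γ)|})
    (fun S _ => by
      by_cases h : S ∈ {S : Fin N → Dataset 𝒳 c n | ∃ γ ∈ Set.Ioc (0 : ℝ) 1,
          N * (ε / 2) < |deviation P S (paramLoss B F C t γ)|}
      · exact Or.inr h
      · refine Or.inl fun γ hγ => isEpsOptimal_of_abs_deviation_le B C t hN0 P S
          (fun γ hγ => ?_) hγ
        by_contra hlt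
        exact h ⟨γ, hγ, not_le.1 hlt⟩)
  have hunion := measureReal_union_le (μ := Measure.pi fun _ : Fin N => P)
    {S | ∀ γ, IsERM B F C t S γ → IsEpsOptimal B F C t P ε γ}
    {S | ∃ γ ∈ Set.Ioc (0 : ℝ) 1, N * (ε / 2) < |deviation P S (paramLoss B F C t γ)|}
  rw [probReal_univ] at hcover
  linarith

end
end TopDown

end

theorem mainTheorem3 :
    (∃ A : ℝ, 0 < A ∧
      ∀ (𝒳 : Type u) [MeasurableSpace 𝒳] (c n t N : ℕ) (F : Finset (𝒳 → Bool))
        (B : TopDown.TieBreak 𝒳 c) (C ε δ : ℝ)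
        (P : MeasureTheory.Measure (TopDown.Dataset 𝒳 c n)) [MeasureTheory.IsProbabilityMeasure P],
        F.Nonempty → (∀ f ∈ F, Measurable f) → 1 ≤ t → 0 < ε → 0 < δ →
        A * (1 / ε ^ 2 * (t * (Real.log F.card + Real.log t) + Real.log (1 / δ))) ≤ N →
        1 - δ ≤ (MeasureTheory.Measure.pi fun _ : Fin N => P).real
          {S | ∀ γ, TopDown.IsERM B F C t S γ → TopDown.IsEpsOptimal B F C t P ε γ}) ∧
    (∃ K : ℕ, ∀ (𝒳 : Type u) (c n : ℕ) (B : TopDown.TieBreak 𝒳 c) (C : ℝ)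
        (D : TopDown.Dataset 𝒳 c n) (T : TopDown.DTree 𝒳 c) (a₁ a₂ : List Bool) (f₁ f₂ : 𝒳 → Bool),
        a₁ ∈ T.leaves → a₂ ∈ T.leaves →
        (∀ γ ∈ Set.Ioc (0 : ℝ) 1, TopDown.splitFun C γ D (TopDown.split B D T a₁ f₁) =
          TopDown.splitFun C γ D (TopDown.split B D T a₂ f₂)) ∨
        {γ ∈ Set.Ioc (0 : ℝ) 1 | TopDown.splitFun C γ D (TopDown.split B D T a₁ f₁) =
          TopDown.splitFun C γ D (TopDown.split B D T a₂ f₂)}.encard ≤ K) := by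
  -- `1048576 = 32768 * 8 * 4`: the chaining constant, the factor `8` in the bound on `Λ`, and `4`
  -- from using `ε / 2`.
  refine ⟨⟨1048576, by norm_num, ?_⟩, 5, ?_⟩
  · intro 𝒳 _ c n t N F B C ε δ P _ hF hFm ht hε hδ hN
    exact TopDown.one_sub_le_measureReal_isERM_imp B hF hFm C ht N P hε hδ hN
  · intro 𝒳 c n B C D T a₁ a₂ f₁ f₂ h₁ h₂
    exact TopDown.encard_eq_splitFun_le B C D T a₁ a₂ f₁ f₂ h₁ h₂
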